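/- Let $\mathcal O$ be a complete discrete valuation ring with algebraically closed residue field, $\pi$ a uniformizer, $F$ its fraction field and $\bar F$ an algebraic closure of $F$. Let $\mathrm{val}$ be the valuation on $F$ normalized by $\mathrm{val}(\pi)=-1$, $\mathrm{val}(0)=-\infty$ (so $\mathrm{val}(x+y)\le\max\{\mathrm{val}\,x,\mathrm{val}\,y\}$), extended to $\mathrm{val}:\bar F^\times\to\mathbb Q$. Let $(X^*(A),\Phi,X_*(A),\Phi^\vee)$ be the (reduced) root datum of a split connected reductive group $G$ over $\mathcal O$ with split maximal torus $A$, and assume that the derived group of $G$ is simply connected, i.e. that $X_*(A)/\mathbb Z\Phi^\vee$ is torsion-free. Let $W$ be the Weyl group, $\alpha_1,\dots,\alpha_l$ a base of simple roots, and $\alpha_1^\vee,\dots,\alpha_l^\vee$ the simple coroots. Let $\omega_1,\dots,\omega_l\in X^*(A)$ satisfy $\langle\omega_i,\alpha_j^\vee\rangle=\delta_{ij}$, and let $\omega_{l+1},\dots,\omega_n$ be a $\mathbb Z$-basis of $X^*(D)=\{\lambda\in X^*(A):\langle\lambda,\alpha^\vee\rangle=0\ \forall\alpha^\vee\in\Phi^\vee\}$.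 Put $\mathfrak a=X_*(A)\otimes\mathbb R=\mathrm{Hom}(X^*(A),\mathbb R)$ and $\mathfrak a_{\rm dom}=\{x:\langle\alpha_i,x\rangle\ge0\text{ for }i\le l\}$; write $x\le y$ if $y-x$ is a non-negative real combination of simple coroots. For $S\subseteq\{1,\dots,l\}$ let $\mathfrak a_S=\{x:\langle\alpha_i,x\rangle=0\ \forall i\in S\}$, let $p_S$ be the projection of $\mathfrak a$ onto $\mathfrak a_S$ along the span of the $\alpha_i^\vee$ ($i\in S$), and put $$\mathcal N_G=\bigcup_{S}\{x\in p_S(X_*(A)):\langle\alpha_i,x\rangle>0\ \forall i\notin S\}.$$ Fix a $W$-invariant inner product on $\mathfrak a$, let $r:\mathfrak a\to\mathfrak a_{\rm dom}$ send $x$ to the closest point of $\mathfrak a_{\rm dom}$, identify $\mathfrak a$ with $\mathbb R^n$ by $x\mapsto(\langle\omega_i,x\rangle)_i$, and write $r$ also for the extension by continuity to $(\mathbb R\cup\{-\infty\})^l\times\mathbb R^{n-l}$. Let $\mathbb A=A/W=\operatorname{Spec}F[X^*(A)]^W$ and $c_i=\sum_{\lambda\in W\omega_i}e^\lambda\in F[X^*(A)]^W$;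 let $c:A\to\mathbb A$ be the quotient map. For $c\in\mathbb A(F)$ with coordinates $(c_1,\dots,c_n)$ let $d_c=(\mathrm{val}\,c_1,\dots,\mathrm{val}\,c_n)$, and for $\mu\in\mathcal N_G$ put $\mathbb A(F)_\mu=\{c:r(d_c)=\mu\}$ and $\mathbb A(F)_{\le\mu}=\{c:r(d_c)\le\mu\}$. For $a\in A(\bar F)$ let $\nu_a\in\mathfrak a$ be defined by $\langle\lambda,\nu_a\rangle=\mathrm{val}\,\lambda(a)$ for all $\lambda\in X^*(A)$. Then the coordinates $(c_1,\dots,c_n)$ give a bijection $\mathbb A(F)\to F^l\times(F^\times)^{n-l}$, and: 1. The sets $\mathbb A(F)_\mu$ ($\mu\in\mathcal N_G$) are non-empty, and $\mathbb A(F)=\coprod_{\mu\in\mathcal N_G}\mathbb A(F)_\mu$. 2. For $\mu\in\mathcal N_G$, $\mathbb A(F)_{\le\mu}=\coprod_{\nu\in\mathcal N_G,\ \nu\le\mu}\mathbb A(F)_\nu$. 3. For $\mu\in\mathcal N_G$, $\mathbb A(F)_{\le\mu}$ consists of the points $(c_1,\dots,c_n)$ with $\mathrm{val}\,c_i\le\langle\omega_i,\mu\rangle$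 for $i=1,\dots,l$ and $\mathrm{val}\,c_i=\langle\omega_i,\mu\rangle$ for $i=l+1,\dots,n$. 4. For $\mu\in\mathcal N_G$, $\mathbb A(F)_\mu$ consists of the points $(c_1,\dots,c_n)$ with $\mathrm{val}\,c_i\le\langle\omega_i,\mu\rangle$ for $i\in I_\mu$ and $\mathrm{val}\,c_i=\langle\omega_i,\mu\rangle$ for $i\notin I_\mu$, where $I_\mu=\{i\in\{1,\dots,l\}:\langle\alpha_i,\mu\rangle=0\}$. 5. Every $c\in\mathbb A(F)$ is of the form $c(a)$ for some $a\in A(\bar F)$; and for $c\in\mathbb A(F)$, any $a\in A(\bar F)$ with $c(a)=c$, and any $\mu\in\mathcal N_G$, one has $c\in\mathbb A(F)_\mu$ if and only if $\mu$ is the unique dominant element of the $W$-orbit of $\nu_a$. -/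

import Mathlib

open Filter Topology WithZero

noncomputable section

namespace NewtonStrata

/-! ### The adjoint quotient of a split torus

`P : RootPairing ι ℤ X Y` is the root datum `(X^*(A), Φ, X_*(A), Φ^∨)`; its Weyl group
`P.weylGroup` acts on `X = X^*(A)`. The split torus is `A = Spec F[X]`, so that `A(K)` is the set
`AddMonoidAlgebra F X →ₐ[F] K`, and the character `λ` of `A` is the basis element `e^λ` of `F[X]`. -/

section Quotient

variable {ι X Y : Type*} [AddCommGroup X] [AddCommGroup Y] (P : RootPairing ι ℤ X Y)
variable (F : Type*) [Field F]

/-- The automorphism `e^λ ↦ e^{wλ}` of the group algebra `F[X]`, for `w` in the Weyl group. -/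
def weylAct (w : P.weylGroup) : AddMonoidAlgebra F X ≃ₐ[F] AddMonoidAlgebra F X :=
  AddMonoidAlgebra.domCongr F F (DistribMulAction.toAddEquiv X w)

/-- The ring `R = F[X]^W` of regular functions on `A/W`. -/
def invariants : Subalgebra F (AddMonoidAlgebra F X) :=
  ⨅ w : P.weylGroup, AlgHom.equalizer (weylAct P F w : AddMonoidAlgebra F X →ₐ[F] _) (AlgHom.id F _)

theorem mem_invariants {f : AddMonoidAlgebra F X} :
    f ∈ invariants P F ↔ ∀ w : P.weylGroup, weylAct P F w f = f := by
  simp [invariants, Algebra.mem_iInf, AlgHom.mem_equalizer]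

/-- The sum of the `e^λ` over the (finite) Weyl group orbit of `lam`, in `F[X]`. -/
def orbitSum (lam : X) : AddMonoidAlgebra F X :=
  ∑ᶠ l ∈ MulAction.orbit P.weylGroup lam, AddMonoidAlgebra.single l (1 : F)

theorem orbitSum_mem (lam : X) : orbitSum P F lam ∈ invariants P F := by
  rw [mem_invariants]
  intro w
  have key : ∀ l : X, weylAct P F w (AddMonoidAlgebra.single l (1 : F)) =
      AddMonoidAlgebra.single (w • l) 1 := by
    intro l
    simp [weylAct]
  unfold orbitSum
  have h1 := (weylAct P F w).toAddEquiv.map_finsum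
    (fun l : X => ∑ᶠ _ : l ∈ MulAction.orbit P.weylGroup lam, AddMonoidAlgebra.single l (1 : F))
  refine h1.trans ?_
  have h2 : ∀ l : X, (weylAct P F w).toAddEquiv
      (∑ᶠ _ : l ∈ MulAction.orbit P.weylGroup lam, AddMonoidAlgebra.single l (1 : F)) =
      ∑ᶠ _ : w • l ∈ MulAction.orbit P.weylGroup lam, AddMonoidAlgebra.single (w • l) (1 : F) := by
    intro l
    rw [AddEquiv.map_finsum]
    refine finsum_congr_Prop ?_ fun _ => key l
    rw [← MulAction.orbit_eq_iff, ← MulAction.orbit_eq_iff, MulAction.orbit_smul]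
  rw [finsum_congr h2]
  exact finsum_comp_equiv (MulAction.toPerm w)
    (f := fun l : X => ∑ᶠ _ : l ∈ MulAction.orbit P.weylGroup lam,
      AddMonoidAlgebra.single l (1 : F))

/-- The set `(A/W)(K)` of `K`-points of `A/W = Spec F[X]^W`. -/
abbrev AdjQuotient (K : Type*) [Field K] [Algebra F K] := invariants P F →ₐ[F] K

/-- The quotient map `A(K) → (A/W)(K)`. -/
def quotientMap {K : Type*} [Field K] [Algebra F K] (a : AddMonoidAlgebra F X →ₐ[F] K) :
    AdjQuotient P F K :=
  a.comp (invariants P F).val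

/-- The inclusion `(A/W)(F) → (A/W)(K)`, for an extension field `K` of `F`. -/
def extendPoint (K : Type*) [Field K] [Algebra F K] (c : AdjQuotient P F F) :
    AdjQuotient P F K :=
  (Algebra.ofId F K).comp c

/-- The coordinates `(c_i)` of a point of `(A/W)(F)`, where `c_i` is the orbit sum of `ω i`. -/
def coords {I : Type*} (ω : I → X) (c : AdjQuotient P F F) : I → F :=
  fun i => c ⟨orbitSum P F (ω i), orbitSum_mem P F (ω i)⟩

end Quotient

/-! ### The space `𝔞`, dominance, and the index set `𝒩_G` -/

section RootTheory

/-- `𝔞 = X_*(A) ⊗ ℝ = Hom(X^*(A), ℝ)`. The pairing `⟨λ, x⟩` is `x λ`. -/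
abbrev Cochar (X : Type*) [AddCommGroup X] := X →ₗ[ℤ] ℝ

/-- The usual topology on the finite-dimensional real vector space `𝔞`
(that of pointwise convergence). -/
instance {X : Type*} [AddCommGroup X] : TopologicalSpace (Cochar X) :=
  TopologicalSpace.induced (fun (x : Cochar X) (l : X) => x l) inferInstance

variable {ι X Y : Type*} [AddCommGroup X] [AddCommGroup Y]
variable (P : RootPairing ι ℤ X Y) (b : P.Base)

/-- The map `X_*(A) → 𝔞`. -/
def toCochar (y : Y) : Cochar X :=
  (Algebra.linearMap ℤ ℝ).comp (P.toLinearMap.flip y)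

/-- The image in `𝔞` of the simple coroot `α_i^∨`. -/
def simpleCoroot (i : b.support) : Cochar X := toCochar P (P.coroot i)

/-- `x` is dominant. -/
def IsDominant (x : Cochar X) : Prop := ∀ i : b.support, 0 ≤ x (P.root i)

/-- `x ≤ y`: the difference `y - x` is a non-negative linear combination of simple coroots. -/
def DomLE (x y : Cochar X) : Prop :=
  ∃ t : b.support → ℝ, (∀ i, 0 ≤ t i) ∧ y - x = ∑ i, t i • simpleCoroot P b i

/-- The orbit of `x ∈ 𝔞` under the Weyl group, which acts by `⟨λ, w x⟩ = ⟨w⁻¹ λ, x⟩`. -/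
def weylOrbit (x : Cochar X) : Set (Cochar X) :=
  {y | ∃ w : P.weylGroup, ∀ l : X, y l = x (w⁻¹ • l)}

/-- The subspace `𝔞_M` of `𝔞`, for the standard Levi subgroup `M` with `Δ_M = S`. -/
def leviSpace (S : Set b.support) : Submodule ℝ (Cochar X) where
  carrier := {x | ∀ i ∈ S, x (P.root i) = 0}
  zero_mem' := by simp
  add_mem' := by
    intro x y hx hy i hi
    simp [hx i hi, hy i hi]
  smul_mem' := by
    intro t x hx i hi
    simp [hx i hi]

/-- The span of the simple coroots of `M`, which is the complement of `𝔞_M` in `𝔞`. -/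
def leviCorootSpan (S : Set b.support) : Submodule ℝ (Cochar X) :=
  Submodule.span ℝ (simpleCoroot P b '' S)

/-- `y = p_M(x)`, for the projection `p_M` of `𝔞` on `𝔞_M` along the span of the simple
coroots of `M`. -/
def IsLeviProj (S : Set b.support) (x y : Cochar X) : Prop :=
  y ∈ leviSpace P b S ∧ x - y ∈ leviCorootSpan P b S

/-- The lattice `Λ_M`, as the image of `X_*(A)` under `p_M`. -/
def leviLattice (S : Set b.support) : Set (Cochar X) :=
  {y | ∃ x : Y, IsLeviProj P b S (toCochar P x) y}

/-- The open cone `𝔞_P^+` in `𝔞_M`, for the standard parabolic subgroup `P = MN`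
with `Δ_M = S` (so that `Δ_N` is the complement of `S`). -/
def parabolicCone (S : Set b.support) : Set (Cochar X) :=
  {x | x ∈ leviSpace P b S ∧ ∀ i ∉ S, 0 < x (P.root i)}

/-- The set `𝒩_G`: the union, over all standard parabolic subgroups `P = MN`, of
`Λ_P^+ = Λ_M ∩ 𝔞_P^+`. -/
def newtonSet : Set (Cochar X) :=
  ⋃ S : Set b.support, leviLattice P b S ∩ parabolicCone P b S

/-- The characters of `A` that are trivial on `A ∩ G_der`, that is, `X^*(D)` for `D = G/G_der`. -/
def charD : Submodule ℤ X where
  carrier := {l | ∀ i, P.toLinearMap l (P.coroot i) = 0}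
  zero_mem' := by simp
  add_mem' := by
    intro x y hx hy i
    simp [hx i, hy i]
  smul_mem' := by
    intro t x hx i
    simp [hx i]

/-- `B` is a Euclidean inner product on `𝔞`, invariant under the Weyl group. -/
structure IsInvariantInner (B : LinearMap.BilinForm ℝ (Cochar X)) : Prop where
  symm : ∀ x y, B x y = B y x
  pos : ∀ x, x ≠ 0 → 0 < B x x
  invariant : ∀ (w : P.weylGroup) (x y x' y' : Cochar X),
    (∀ l : X, x' l = x (w⁻¹ • l)) → (∀ l : X, y' l = y (w⁻¹ • l)) → B x' y' = B x y

/-- `y` is the dominant element closest to `x` in the metric given by `B`. -/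
def IsClosestDominant (B : LinearMap.BilinForm ℝ (Cochar X)) (x y : Cochar X) : Prop :=
  IsDominant P b y ∧ ∀ z, IsDominant P b z → B (x - y) (x - y) ≤ B (x - z) (x - z)

/-- The closest point map `r : 𝔞 → 𝔞_dom`. -/
def closest (B : LinearMap.BilinForm ℝ (Cochar X)) (x : Cochar X) : Cochar X :=
  Classical.epsilon (IsClosestDominant P b B x)

/-- The coordinate map `x ↦ (⟨ω_i, x⟩)_i`, with values regarded as extended real numbers. -/
def cocharCoords {I : Type*} (ω : I → X) (x : Cochar X) : I → EReal :=
  fun i => ((x (ω i) : ℝ) : EReal)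

/-- The extension by continuity of `r` to tuples `d` some of whose coordinates may be `-∞`:
the limit of `r(x)` as the coordinates of `x ∈ 𝔞` tend to `d`. -/
def closestExt (B : LinearMap.BilinForm ℝ (Cochar X)) {I : Type*} (ω : I → X) (d : I → EReal) :
    Cochar X :=
  limUnder (comap (cocharCoords ω) (𝓝 d)) (closest P b B)

end RootTheory

/-! ### Valuations and Newton strata -/

section Strata

open Classical in
/-- The valuation of `F = Frac O`, for a discrete valuation ring `O`, written additively, with
`val π = -1` and `val 0 = -∞`. -/
def val (O : Type*) {F : Type*} [CommRing O] [IsDomain O] [IsDiscreteValuationRing O] [Field F]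
    [Algebra O F] [IsFractionRing O F] (x : F) : EReal :=
  if x = 0 then ⊥
  else (((log ((IsDiscreteValuationRing.maximalIdeal O).valuation F x) : ℤ) : ℝ) : EReal)

/-- The valuation `v` of `K` (an algebraic closure of `F`), with values in `ℚ` when written
additively, extends the valuation of `F = Frac O`. -/
def ExtendsVal (O F : Type*) {K : Type*} [CommRing O] [IsDomain O] [IsDiscreteValuationRing O]
    [Field F] [Algebra O F] [IsFractionRing O F] [Field K] [Algebra F K]
    (v : Valuation K ℚᵐ⁰) : Prop :=
  ∀ x : F, x ≠ 0 → log (v (algebraMap F K x)) =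
    ((log ((IsDiscreteValuationRing.maximalIdeal O).valuation F x) : ℤ) : ℚ)

/-- The element `ν_a` of `𝔞`, with `⟨λ, ν_a⟩ = val λ(a)` for all `λ`. -/
def nu {X F K : Type*} [AddCommGroup X] [Field F] [Field K] [Algebra F K] (v : Valuation K ℚᵐ⁰)
    (a : AddMonoidAlgebra F X →ₐ[F] K) : Cochar X :=
  AddMonoidHom.toIntLinearMap <| AddMonoidHom.mk'
    (fun l => ((log (v (a (AddMonoidAlgebra.single l 1))) : ℚ) : ℝ)) <| by
      have hne : ∀ l : X, v (a (AddMonoidAlgebra.single l 1)) ≠ 0 := by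
        intro l h
        have h0 : a (AddMonoidAlgebra.single l 1) = 0 := (map_eq_zero v).1 h
        have h1 : a (AddMonoidAlgebra.single l 1 * AddMonoidAlgebra.single (-l) 1) = 1 := by
          rw [AddMonoidAlgebra.single_mul_single, add_neg_cancel, one_mul,
            ← AddMonoidAlgebra.one_def, map_one]
        rw [map_mul, h0, zero_mul] at h1
        exact zero_ne_one h1
      intro l m
      have h : (AddMonoidAlgebra.single (l + m) 1 : AddMonoidAlgebra F X) =
          AddMonoidAlgebra.single l 1 * AddMonoidAlgebra.single m 1 := by
        rw [AddMonoidAlgebra.single_mul_single, one_mul]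
      rw [h, map_mul, map_mul, log_mul (hne l) (hne m), Rat.cast_add]

variable {ι X Y : Type*} [AddCommGroup X] [AddCommGroup Y]
variable (P : RootPairing ι ℤ X Y) (b : P.Base) (B : LinearMap.BilinForm ℝ (Cochar X))
variable (O F : Type*) [CommRing O] [IsDomain O] [IsDiscreteValuationRing O] [Field F]
  [Algebra O F] [IsFractionRing O F] {I : Type*} (ω : I → X)

/-- `r(d_c)`, where `d_c = (val c_i)_i`. -/
def newtonPoint (c : AdjQuotient P F F) : Cochar X :=
  closestExt P b B ω fun i => val O (coords P F ω c i)

/-- The Newton stratum `𝔸(F)_μ`. -/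
def stratum (μ : Cochar X) : Set (AdjQuotient P F F) :=
  {c | newtonPoint P b B O F ω c = μ}

/-- The closed Newton stratum `𝔸(F)_{≤ μ}`. -/
def closedStratum (μ : Cochar X) : Set (AdjQuotient P F F) :=
  {c | DomLE P b (newtonPoint P b B O F ω c) μ}

/-- The set `I_μ` of the `i ∈ {1, …, l}` with `⟨α_i, μ⟩ = 0`, inside the index set
`{1, …, l} ⊔ {l + 1, …, n}`. -/
def wallSet (κ : Type*) (μ : Cochar X) : Set (b.support ⊕ κ) :=
  Sum.inl '' {i | μ (P.root i) = 0}

end Strata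

end NewtonStrata

end

/-! Everything is routed through the predicate `Fits w d μ`: the point `μ` is dominant, its central
coordinates are those of `d`, and `d_j ≤ ⟨ω_j, μ⟩` for every simple `j`, with equality off the walls
containing `μ`. For `d = d_c` this is essentially the explicit description of a stratum, so the core
of the theorem is that `r(d_c) = μ` exactly when `μ` fits `d_c` (`newtonPoint_eq_iff`).

Convexity gives one direction. If `μ` fits a finite `x`, then `x - μ` is a non-positive combination
of the simple coroots orthogonal to `μ`, and such a vector makes a non-acute angle with `z - μ` for
every dominant `z`. This is the variational property of the closest point, and non-expansiveness of
projections carries it to coordinates equal to `-∞` (`Fits.closestExt_eq`).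

For the converse some fitting point must exist, and the torus supplies it. Since `F[X]` is integral
over its invariants, `c` lifts to some `a ∈ A(K)`, and a Weyl conjugate of `a` has `ν_a` dominant.
Then `c_j` is a sum over the orbit of `ω_j` of values `λ(a)`. The ultrametric inequality bounds it
by the term of `ω_j`, and when `⟨α_j, ν_a⟩ > 0` that term strictly dominates. Hence `ν_a` fits `d_c`
(`fits_nu`), which also settles the last assertion.

The bijectivity of the coordinates is a leading-term argument: the invariants have a basis of
monomials in the orbit sums, the central ones being inverted (`monomialAlgHom_bijective`). Strata
are then non-empty because coordinates can be prescribed. Closed strata come from `Fits.domLE_iff`,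
which rests on distinct simple coroots forming non-acute angles. -/

set_option linter.unusedSectionVars false

noncomputable section

namespace NewtonStrata

open RootPairing

/-! ### Weyl group combinatorics: words, exchange, dominant characters, height. -/

section Weyl

variable {ι X Y : Type*} [AddCommGroup X] [AddCommGroup Y] {P : RootPairing ι ℤ X Y}

theorem smul_eq_reflection (i : ι) (x : X) : weylGroup.ofIdx P i • x = P.reflection i x := rfl

theorem weylGroup_ext {w w' : P.weylGroup} (h : ∀ x : X, w • x = w' • x) : w = w' :=
  Subtype.ext (Equiv.weightHom_injective P (LinearEquiv.ext h))

theorem ofIdx_mul_self (i : ι) : weylGroup.ofIdx P i * weylGroup.ofIdx P i = 1 :=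
  weylGroup_ext fun x => by rw [mul_smul, smul_eq_reflection, smul_eq_reflection, one_smul,
    reflection_same]

theorem weylGroupToPerm_ofIdx (i j : ι) :
    P.weylGroupToPerm (weylGroup.ofIdx P i) j = P.reflectionPerm i j := rfl

theorem pairing_smul (w : P.weylGroup) (x : X) (i : ι) :
    P.toLinearMap (w • x) (P.coroot (P.weylGroupToPerm w i)) = P.toLinearMap x (P.coroot i) := by
  obtain ⟨w, hw⟩ := w
  induction hw using weylGroup.induction generalizing x i with
  | mem j =>
    change P.toLinearMap (P.reflection j x) (P.coroot (P.reflectionPerm j i)) = _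
    rw [P.coroot_reflectionPerm]
    simp [reflection_apply, coreflection_apply]
    ring
  | one => simp
  | mul g₁ g₂ hg₁ hg₂ h₁ h₂ =>
    rw [← Submonoid.mk_mul_mk _ _ _ hg₁ hg₂]
    rw [map_mul, mul_smul, Equiv.Perm.mul_apply, h₁, h₂]

theorem zsmul_smul (w : P.weylGroup) (n : ℤ) (x : X) : w • (n • x) = n • (w • x) :=
  smul_comm w n x

theorem smul_sub_mem_rootSpan (w : P.weylGroup) (x : X) : w • x - x ∈ P.rootSpan ℤ := by
  obtain ⟨w, hw⟩ := w
  induction hw using weylGroup.induction generalizing x with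
  | mem j =>
    change P.reflection j x - x ∈ _
    rw [reflection_apply, sub_sub_cancel_left]
    exact neg_mem (Submodule.smul_mem _ _ (Submodule.subset_span ⟨j, rfl⟩))
  | one => simp
  | mul g₁ g₂ hg₁ hg₂ h₁ h₂ =>
    rw [← Submonoid.mk_mul_mk _ _ _ hg₁ hg₂, mul_smul]
    simpa using add_mem (h₁ ((⟨g₂, hg₂⟩ : P.weylGroup) • x)) (h₂ x)

theorem smul_eq_self_of_pairing_eq_zero {x : X} (hx : ∀ i, P.toLinearMap x (P.coroot i) = 0)
    (w : P.weylGroup) : w • x = x := by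
  obtain ⟨w, hw⟩ := w
  induction hw using weylGroup.induction with
  | mem j =>
    change P.reflection j x = x
    rw [reflection_apply]
    simp [hx]
  | one => simp
  | mul g₁ g₂ hg₁ hg₂ h₁ h₂ =>
    rw [← Submonoid.mk_mul_mk _ _ _ hg₁ hg₂, mul_smul, h₂, h₁]

variable (b : P.Base)

/-- The product of the simple reflections in a word. -/
def wordProd (L : List b.support) : P.weylGroup :=
  (L.map fun i : b.support => weylGroup.ofIdx P (i : ι)).prod

theorem wordProd_nil : wordProd b [] = 1 := rfl

theorem wordProd_cons (i : b.support) (L : List b.support) :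
    wordProd b (i :: L) = weylGroup.ofIdx P i * wordProd b L := rfl

theorem wordProd_concat (L : List b.support) (i : b.support) :
    wordProd b (L ++ [i]) = wordProd b L * weylGroup.ofIdx P i := by
  simp [wordProd]

/-- Converts signs of pairings with coroots into signs of an invariant form, and back. -/
theorem two_mul_rootForm [Fintype ι] (i : ι) (x : X) :
    2 * P.RootForm (P.root i) x =
      P.RootForm (P.root i) (P.root i) * P.toLinearMap x (P.coroot i) := by
  have := congrArg (P.toLinearMap x) (P.rootForm_self_smul_coroot i)
  rw [map_smul, map_nsmul, toLinearMap_apply_apply_Polarization] at this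
  simpa using this.symm

theorem rootForm_root_self_pos [Fintype ι] (i : ι) : 0 < P.RootForm (P.root i) (P.root i) :=
  P.rootForm_pos_of_ne_zero (Submodule.subset_span ⟨i, rfl⟩) (P.ne_zero i)

theorem rootForm_smul_smul [Fintype ι] (w : P.weylGroup) (x y : X) :
    P.RootForm (w • x) (w • y) = P.RootForm x y :=
  InvariantForm.apply_weylGroup_smul P (B := P.toInvariantForm) w x y

theorem exists_root_eq_sum_of_isPos {i : ι} (h : b.IsPos i) :
    ∃ n : b.support → ℕ, P.root i = ∑ j, n j • P.root (j : ι) := by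
  obtain ⟨f, -, hf | hf⟩ := b.exists_root_eq_sum_nat_or_neg i
  · exact ⟨fun j => f j, by rw [hf, ← Finset.sum_coe_sort]⟩
  · exfalso
    have hf' : P.root i = ∑ j ∈ b.support, (-(f j : ℤ)) • P.root j := by
      rw [hf, ← Finset.sum_neg_distrib]
      exact Finset.sum_congr rfl fun j _ => by module
    rw [RootPairing.Base.isPos_iff, b.height_eq_sum hf'] at h
    refine h.not_ge (Finset.sum_nonpos fun j _ => by simp)

open Classical in
/-- The pairing with the sum of the positive coroots. -/
def heightHom : X →+ ℤ :=
  ((P.toLinearMap.flip (∑ᶠ i ∈ {i | b.IsPos i}, P.coroot i)) : X →ₗ[ℤ] ℤ).toAddMonoidHom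

open Classical in
theorem heightHom_apply [Fintype ι] (x : X) :
    heightHom b x = ∑ i with b.IsPos i, P.toLinearMap x (P.coroot i) := by
  rw [heightHom, finsum_mem_eq_finite_toFinset_sum _ (Set.toFinite _)]
  simp

variable [Finite ι]

/-- If `w` fixes every root, then `w • x - x` is orthogonal to all coroots; it also lies in the root
span, where the root form is definite. Finiteness of the Weyl group follows. -/
theorem weylGroupToPerm_injective : Function.Injective P.weylGroupToPerm := by
  have := Fintype.ofFinite ι
  refine (injective_iff_map_eq_one _).2 fun w hw => weylGroup_ext fun x => ?_
  rw [one_smul, ← sub_eq_zero]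
  refine P.eq_zero_of_mem_rootSpan_of_rootForm_self_eq_zero (smul_sub_mem_rootSpan w x) ?_
  have key (i : ι) : P.toLinearMap (w • x - x) (P.coroot i) = 0 := by
    have h := pairing_smul w x i
    rw [hw, Equiv.Perm.one_apply] at h
    rw [map_sub, LinearMap.sub_apply, h, sub_self]
  rw [rootForm_apply_apply]
  exact Finset.sum_eq_zero fun i _ => by
    rw [show P.coroot' i (w • x - x) = 0 from key i, zero_mul]

instance : Finite P.weylGroup := Finite.of_injective _ weylGroupToPerm_injective

/-- `x` is a dominant character. -/
def IsDominantChar (x : X) : Prop := ∀ i : b.support, 0 ≤ P.toLinearMap x (P.coroot i)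

variable {b}

/-- A positive root is a sum of simple roots, each of which has non-negative root form with `x`. -/
theorem IsDominantChar.pairing_nonneg {x : X} (hx : IsDominantChar b x) {i : ι} (h : b.IsPos i) :
    0 ≤ P.toLinearMap x (P.coroot i) := by
  have := Fintype.ofFinite ι
  have h1 := two_mul_rootForm (P := P) i x
  have h2 : 0 ≤ P.RootForm (P.root i) x := by
    obtain ⟨n, hn⟩ := exists_root_eq_sum_of_isPos b h
    rw [hn, map_sum, LinearMap.sum_apply]
    refine Finset.sum_nonneg fun j _ => ?_
    rw [map_nsmul, LinearMap.smul_apply]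
    refine nsmul_nonneg ?_ _
    have h3 := two_mul_rootForm (P := P) j x
    have := mul_nonneg (rootForm_root_self_pos (P := P) (j : ι)).le (hx j)
    lia
  refine nonneg_of_mul_nonneg_right (a := P.RootForm (P.root i) (P.root i)) ?_
    (rootForm_root_self_pos i)
  lia

/-- As `w` preserves the form, `g = x - w • x` satisfies `(g, g) = 2 (g, x)`. This is positive, so
some simple root occurring in `g` has positive product with `x`. For a fundamental weight this pins
down which simple root occurs. -/
theorem exists_ne_zero_of_sub_smul_eq {x : X} {w : P.weylGroup} {n : b.support → ℕ}
    (hn : x - w • x = ∑ j, n j • P.root (j : ι)) (hne : w • x ≠ x) :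
    ∃ j : b.support, n j ≠ 0 ∧ 0 < P.toLinearMap x (P.coroot j) := by
  have := Fintype.ofFinite ι
  by_contra! hcon
  set g := x - w • x with hg
  have hg0 : 0 < P.RootForm g g := by
    refine P.rootForm_pos_of_ne_zero ?_ (sub_ne_zero.2 hne.symm)
    rw [hg, ← neg_sub]
    exact neg_mem (smul_sub_mem_rootSpan w x)
  have h1 : P.RootForm (w • x) (w • x) = P.RootForm x x := rootForm_smul_smul w x x
  rw [show w • x = x - g by rw [hg]; abel] at h1
  have h2 : P.RootForm x g = P.RootForm g x := P.rootForm_symmetric.eq x g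
  simp only [map_sub, LinearMap.sub_apply, h2] at h1
  have h3 : P.RootForm g x ≤ 0 := by
    rw [hn, map_sum, LinearMap.sum_apply]
    refine Finset.sum_nonpos fun j _ => ?_
    rw [map_nsmul, LinearMap.smul_apply]
    by_cases h0 : n j = 0
    · simp [h0]
    · refine nsmul_nonpos ?_ _
      have h4 := two_mul_rootForm (P := P) j x
      have := mul_nonpos_of_nonneg_of_nonpos (rootForm_root_self_pos (P := P) (j : ι)).le
        (hcon j h0)
      lia
  lia

variable (b) [P.IsReduced]

/-- Every root is reached from a simple one by simple reflections, and the reflection in `s_j α_i`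
is `s_j s_i s_j`. -/
theorem exists_word (w : P.weylGroup) : ∃ L : List b.support, w = wordProd b L := by
  let S : Submonoid P.weylGroup :=
    Submonoid.closure (Set.range fun i : b.support => weylGroup.ofIdx P i)
  have hS (i : ι) : weylGroup.ofIdx P i ∈ S := by
    refine b.induction_reflect i (p := fun i => weylGroup.ofIdx P i ∈ S) ?_ ?_ ?_
    · intro i hi
      have : weylGroup.ofIdx P (P.reflectionPerm i i) = weylGroup.ofIdx P i := by
        refine weylGroup_ext fun x => ?_
        rw [smul_eq_reflection, smul_eq_reflection, reflection_reflectionPerm]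
        simp
      rwa [this]
    · exact fun i hi => Submonoid.subset_closure ⟨⟨i, hi⟩, rfl⟩
    · intro i j hi hj
      have : weylGroup.ofIdx P (P.reflectionPerm j i) =
          weylGroup.ofIdx P j * weylGroup.ofIdx P i * weylGroup.ofIdx P j := by
        refine weylGroup_ext fun x => ?_
        rw [mul_smul, mul_smul, smul_eq_reflection, smul_eq_reflection, smul_eq_reflection,
          smul_eq_reflection, reflection_reflectionPerm]
        rfl
      rw [this]
      have := Submonoid.subset_closure (s := Set.range fun i : b.support => weylGroup.ofIdx P i)
        ⟨⟨j, hj⟩, rfl⟩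
      exact S.mul_mem (S.mul_mem this hi) this
  have hw : w ∈ S := by
    obtain ⟨w, hw⟩ := w
    induction hw using weylGroup.induction with
    | mem i => exact hS i
    | one => exact S.one_mem
    | mul g₁ g₂ hg₁ hg₂ h₁ h₂ => exact S.mul_mem h₁ h₂
  obtain ⟨l, hl, rfl⟩ := Submonoid.exists_list_of_mem_closure hw
  obtain ⟨L, rfl⟩ : l ∈ Set.range (List.map fun i : b.support => weylGroup.ofIdx P (i : ι)) := by
    rw [Set.range_list_map]
    exact hl
  exact ⟨L, rfl⟩

/-- The exchange condition. -/
theorem exists_word_of_not_isPos (L : List b.support) (i : b.support)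
    (h : ¬ b.IsPos (P.weylGroupToPerm (wordProd b L) i)) :
    ∃ L' : List b.support, L'.length + 1 = L.length ∧
      wordProd b L * weylGroup.ofIdx P i = wordProd b L' := by
  induction L with
  | nil => exact absurd (b.isPos_of_mem_support i.2) (by simpa [wordProd_nil] using h)
  | cons j L ih =>
    simp only [wordProd_cons] at h ⊢
    by_cases h' : b.IsPos (P.weylGroupToPerm (wordProd b L) i)
    · refine ⟨L, by simp, ?_⟩
      set w := wordProd b L
      -- The only positive root made negative by `s_j` is `α_j`. So `w α_i = α_j`, whence `s_j w s_i
      -- = w` and the letter `j` can be deleted.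
      have hj : P.weylGroupToPerm w i = j := by
        by_contra hne
        rw [map_mul, Equiv.Perm.mul_apply, weylGroupToPerm_ofIdx] at h
        exact h (h'.reflectionPerm j.2 hne)
      have hr : P.root j = w • P.root i := by rw [weylGroup_apply_root, hj]
      have hr2 : P.toLinearMap (P.root j) (P.coroot j) = 2 := P.root_coroot_two _
      refine weylGroup_ext fun x => ?_
      have h1 : P.toLinearMap (w • x) (P.coroot j) = P.toLinearMap x (P.coroot i) := by
        rw [← hj, pairing_smul]
      rw [mul_smul, mul_smul, smul_eq_reflection, smul_eq_reflection, P.reflection_apply i,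
        smul_sub, zsmul_smul, ← hr, reflection_apply]
      simp only [coroot', map_sub, map_zsmul, LinearMap.flip_apply, h1, hr2]
      generalize w • x = y
      module
    · obtain ⟨L', hL, hw⟩ := ih h'
      exact ⟨j :: L', by simp [hL], by rw [mul_assoc, hw, wordProd_cons]⟩

variable {b}

/-- Induction on the length of a word `u s_i`. If `u α_i` is positive, passing from `u` to `u s_i`
adds `⟨x, α_i^∨⟩ u α_i` to the difference; otherwise the exchange condition gives a shorter word. -/
theorem IsDominantChar.exists_sub_smul_eq {x : X} (hx : IsDominantChar b x) (w : P.weylGroup) :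
    ∃ n : b.support → ℕ, x - w • x = ∑ j, n j • P.root (j : ι) := by
  obtain ⟨L, rfl⟩ := exists_word b w
  generalize hl : L.length = l
  induction l using Nat.strong_induction_on generalizing L with
  | _ l ih =>
  rcases List.eq_nil_or_concat L with rfl | ⟨L, i, rfl⟩
  · exact ⟨0, by simp [wordProd_nil]⟩
  rw [List.concat_eq_append] at hl ⊢
  rw [wordProd_concat]
  simp only [List.length_append, List.length_singleton] at hl
  by_cases h : b.IsPos (P.weylGroupToPerm (wordProd b L) i)
  · obtain ⟨n, hn⟩ := ih _ (by lia) L rfl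
    obtain ⟨m, hm⟩ := exists_root_eq_sum_of_isPos b h
    obtain ⟨c, hc⟩ := Int.eq_ofNat_of_zero_le (hx i)
    refine ⟨n + c • m, ?_⟩
    rw [mul_smul, smul_eq_reflection, P.reflection_apply, smul_sub, zsmul_smul,
      weylGroup_apply_root, hm, coroot', LinearMap.flip_apply, hc]
    simp only [Pi.add_apply, Pi.smul_apply, add_smul, Finset.sum_add_distrib, ← hn, smul_assoc,
      ← Finset.smul_sum, natCast_zsmul]
    abel
  · obtain ⟨L', hL, hw⟩ := exists_word_of_not_isPos b L i h
    rw [hw]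
    exact ih _ (by lia) L' rfl

variable (b)

theorem heightHom_nonneg {x : X} (hx : IsDominantChar b x) : 0 ≤ heightHom b x := by
  classical
  have := Fintype.ofFinite ι
  rw [heightHom_apply]
  exact Finset.sum_nonneg fun i hi => hx.pairing_nonneg (by simpa using hi)

/-- The reflection `s_i` permutes the positive roots other than `α_i` and negates `α_i`, so their
coroots contribute a sum equal to its own negative. Only `⟨α_i, α_i^∨⟩` remains. -/
theorem heightHom_root (i : b.support) : heightHom b (P.root i) = 2 := by
  classical
  have := Fintype.ofFinite ι
  rw [heightHom_apply, ← Finset.add_sum_erase _ _ (a := (i : ι))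
    (by simpa using b.isPos_of_mem_support i.2)]
  set S := (Finset.univ.filter fun i => b.IsPos i).erase (i : ι) with hS
  have hmem {j : ι} (hj : j ∈ S) : P.reflectionPerm i j ∈ S := by
    simp only [hS, Finset.mem_erase, Finset.mem_filter, Finset.mem_univ, true_and] at hj ⊢
    refine ⟨fun h => ?_, hj.2.reflectionPerm i.2 hj.1⟩
    have h1 := (RootPairing.Base.IsPos.neg_iff_not b (i : ι)).1
    have h2 : P.reflectionPerm i i = j := by
      rw [← reflectionPerm_self P i j, h]
    exact h1 (show b.IsPos (P.reflectionPerm i i) from h2 ▸ hj.2) (b.isPos_of_mem_support i.2)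
  have h0 : ∑ j ∈ S, P.toLinearMap (P.root i) (P.coroot j) =
      ∑ j ∈ S, -P.toLinearMap (P.root i) (P.coroot j) := by
    refine Finset.sum_nbij' (P.reflectionPerm i) (P.reflectionPerm i) (fun j => hmem)
      (fun j => hmem) (by simp) (by simp) fun j _ => ?_
    rw [← pairing_smul (weylGroup.ofIdx P i), smul_eq_reflection, reflection_apply_self, map_neg,
      LinearMap.neg_apply, weylGroupToPerm_ofIdx]
  rw [Finset.sum_neg_distrib] at h0
  have : P.toLinearMap (P.root i) (P.coroot i) = 2 := P.root_coroot_two _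
  lia

theorem IsDominantChar.heightHom_smul_lt {x : X} (hx : IsDominantChar b x) {w : P.weylGroup}
    (hw : w • x ≠ x) : heightHom b (w • x) < heightHom b x := by
  obtain ⟨n, hn⟩ := hx.exists_sub_smul_eq w
  obtain ⟨j, hj, -⟩ := exists_ne_zero_of_sub_smul_eq hn hw
  have := congrArg (heightHom b) hn
  simp only [map_sub, map_sum, map_nsmul, heightHom_root] at this
  have : 0 < ∑ j, n j • (2 : ℤ) :=
    Finset.sum_pos' (fun _ _ => by positivity) ⟨j, Finset.mem_univ _, by positivity⟩
  lia

/-- A conjugate of maximal height works, because `s_i` changes the height of `y` by `-2 ⟨y, α_i^∨⟩`.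
-/
theorem exists_smul_isDominantChar (x : X) : ∃ w : P.weylGroup, IsDominantChar b (w • x) := by
  obtain ⟨w, hw⟩ := Finite.exists_max fun w : P.weylGroup => heightHom b (w • x)
  refine ⟨w, fun i => ?_⟩
  have := hw (weylGroup.ofIdx P i * w)
  rw [mul_smul, smul_eq_reflection, P.reflection_apply, map_sub, map_zsmul, heightHom_root] at this
  simp only [coroot', LinearMap.flip_apply, smul_eq_mul] at this
  lia

end Weyl

/-! ### The basis of the character lattice adapted to the simple coroots. -/

section WeightBasis

variable {ι X Y : Type*} [AddCommGroup X] [AddCommGroup Y] {P : RootPairing ι ℤ X Y} {b : P.Base}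
variable {κ : Type*}

/-- A basis of the character lattice formed by fundamental weights and by characters
orthogonal to the coroots. -/
structure IsWeightBasis (b : P.Base) (w : Module.Basis (b.support ⊕ κ) ℤ X) : Prop where
  inl : ∀ i j : b.support, P.toLinearMap (w (.inl i)) (P.coroot j) = Finsupp.single i 1 j
  inr : ∀ k i, P.toLinearMap (w (.inr k)) (P.coroot i) = 0

/-- Subtracting `∑ ⟨x, α_j^∨⟩ ω_j` from `x` leaves a character killed by the simple coroots, hence
by all coroots, which are integral combinations of them. Independence follows on pairing with the
simple coroots. -/
theorem exists_isWeightBasis [DecidableEq ι] (ω₁ : b.support → X)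
    (hω₁ : ∀ i j : b.support, P.toLinearMap (ω₁ i) (P.coroot j) = if i = j then 1 else 0)
    (ω₂ : Module.Basis κ ℤ (charD P)) :
    ∃ w : Module.Basis (b.support ⊕ κ) ℤ X, IsWeightBasis b w ∧
      ⇑w = Sum.elim ω₁ (fun k => (ω₂ k : X)) := by
  have hz (x : X) (hx : ∀ j : b.support, P.toLinearMap x (P.coroot j) = 0) : x ∈ charD P := by
    intro i
    have : P.coroot i ∈ LinearMap.ker (P.toLinearMap x) := by
      refine Submodule.span_le.2 ?_ (b.coroot_mem_span_int i)
      rintro _ ⟨j, hj, rfl⟩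
      exact hx ⟨j, hj⟩
    exact this
  have hli : LinearIndependent ℤ (Sum.elim ω₁ (fun k => (ω₂ k : X))) := by
    refine LinearIndependent.sum_type ?_ ?_ ?_
    · rw [Fintype.linearIndependent_iff]
      intro g hg j
      have := congrArg (fun x => P.toLinearMap x (P.coroot j)) hg
      simpa [hω₁] using this
    · exact ω₂.linearIndependent.map' _ (Submodule.ker_subtype _)
    · rw [Submodule.disjoint_def]
      intro x hx hx'
      have hx' : x ∈ charD P := by
        refine Submodule.span_le.2 ?_ hx'
        rintro _ ⟨k, rfl⟩
        exact (ω₂ k).2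
      obtain ⟨g, rfl⟩ := (Submodule.mem_span_range_iff_exists_fun ℤ).1 hx
      refine Finset.sum_eq_zero fun j _ => ?_
      have : P.toLinearMap (∑ i, g i • ω₁ i) (P.coroot j) = 0 := hx' j
      have hj : g j = 0 := by simpa [hω₁] using this
      rw [hj, zero_smul]
  refine ⟨Module.Basis.mk hli ?_, ⟨fun i j => ?_, fun k i => ?_⟩, ?_⟩
  · rintro x -
    set y := ∑ j : b.support, P.toLinearMap x (P.coroot j) • ω₁ j with hy
    have hy' : y ∈ Submodule.span ℤ (Set.range (Sum.elim ω₁ (fun k => (ω₂ k : X)))) :=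
      Submodule.sum_mem _ fun j _ => Submodule.smul_mem _ _ (Submodule.subset_span ⟨.inl j, rfl⟩)
    have hd : x - y ∈ charD P := by
      refine hz _ fun j => ?_
      rw [map_sub, LinearMap.sub_apply, hy]
      simp [hω₁]
    have hd' : x - y ∈ Submodule.span ℤ (Set.range (Sum.elim ω₁ (fun k => (ω₂ k : X)))) := by
      have h1 : (⟨x - y, hd⟩ : charD P) ∈ Submodule.span ℤ (Set.range ω₂) := by
        rw [ω₂.span_eq]; trivial
      have h2 := Submodule.mem_map_of_mem (f := (charD P).subtype) h1
      rw [Submodule.map_span] at h2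
      refine Submodule.span_mono ?_ h2
      rintro _ ⟨_, ⟨k, rfl⟩, rfl⟩
      exact ⟨.inr k, rfl⟩
    simpa using add_mem hd' hy'
  · simp [hω₁, Finsupp.single_apply]
  · simpa using (ω₂ k).2 i
  · simp

variable {w : Module.Basis (b.support ⊕ κ) ℤ X}

theorem IsWeightBasis.repr_inl (hw : IsWeightBasis b w) (x : X) (j : b.support) :
    w.repr x (.inl j) = P.toLinearMap x (P.coroot j) := by
  have : (Finsupp.lapply (.inl j)).comp w.repr.toLinearMap = P.toLinearMap.flip (P.coroot j) := by
    refine w.ext fun i => ?_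
    rcases i with i | k
    · classical simp [hw.inl, Finsupp.single_apply]
    · simp [hw.inr]
  exact LinearMap.congr_fun this x

end WeightBasis

/-! ### Leading characters in the group algebra, with respect to a height. -/

section Leading

variable {F X : Type*} [Field F] [AddCommGroup X]

/-- The character `x` occurs in `f` with coefficient `1`, and every other character of `f` has
smaller height. -/
def IsLeading (h : X →+ ℤ) (f : AddMonoidAlgebra F X) (x : X) : Prop :=
  f.coeff x = 1 ∧ ∀ y, f.coeff y ≠ 0 → y = x ∨ h y < h x

variable {h : X →+ ℤ}

theorem isLeading_single (x : X) : IsLeading h (AddMonoidAlgebra.single x (1 : F)) x := by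
  classical
  refine ⟨by simp, fun y hy => .inl ?_⟩
  by_contra hne
  exact hy (by simp [Ne.symm hne])

/-- Heights add, so `x + y` arises from the supports only as the sum of the two leading characters.
-/
theorem IsLeading.mul {f g : AddMonoidAlgebra F X} {x y : X} (hf : IsLeading h f x)
    (hg : IsLeading h g y) : IsLeading h (f * g) (x + y) := by
  classical
  refine ⟨?_, fun z hz => ?_⟩
  · rw [AddMonoidAlgebra.coeff_mul_add_of_uniqueAdd, hf.1, hg.1, one_mul]
    intro a c ha hc hac
    rw [Finsupp.mem_support_iff] at ha hc
    have hh : h a + h c = h x + h y := by rw [← map_add, hac, map_add]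
    rcases hf.2 a ha with rfl | ha
    · exact ⟨rfl, by simpa using hac⟩
    · rcases hg.2 c hc with rfl | hc
      · exact ⟨by simpa using hac, rfl⟩
      · lia
  · obtain ⟨a, ha, c, hc, rfl⟩ := Finset.mem_add.1
      (AddMonoidAlgebra.support_coeff_mul_subset f g (Finsupp.mem_support_iff.2 hz))
    rw [Finsupp.mem_support_iff] at ha hc
    rw [map_add, map_add]
    rcases hf.2 a ha with rfl | ha <;> rcases hg.2 c hc with rfl | hc
    · exact .inl rfl
    all_goals right; lia

theorem isLeading_one : IsLeading h (1 : AddMonoidAlgebra F X) 0 := isLeading_single 0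

theorem IsLeading.pow {f : AddMonoidAlgebra F X} {x : X} (hf : IsLeading h f x) (n : ℕ) :
    IsLeading h (f ^ n) (n • x) := by
  induction n with
  | zero => simpa using isLeading_one
  | succ n ih => rw [pow_succ, succ_nsmul]; exact ih.mul hf

theorem IsLeading.prod {J : Type*} (s : Finset J) {f : J → AddMonoidAlgebra F X} {x : J → X}
    (hf : ∀ j ∈ s, IsLeading h (f j) (x j)) : IsLeading h (∏ j ∈ s, f j) (∑ j ∈ s, x j) := by
  classical
  induction s using Finset.induction_on with
  | empty => simpa using isLeading_one
  | insert j s hj ih =>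
    rw [Finset.prod_insert hj, Finset.sum_insert hj]
    exact (hf j (by simp)).mul (ih fun i hi => hf i (by simp [hi]))

end Leading

/-! ### The ring of invariants as a mixed polynomial and Laurent polynomial ring. -/

section Invariants

variable {ι X Y : Type*} [AddCommGroup X] [AddCommGroup Y] {P : RootPairing ι ℤ X Y} [Finite ι]
variable {F : Type*} [Field F]

theorem coeff_weylAct (w : P.weylGroup) (f : AddMonoidAlgebra F X) (x : X) :
    (weylAct P F w f).coeff (w • x) = f.coeff x := by
  simp [weylAct, AddMonoidAlgebra.coeff_domCongr]

theorem coeff_smul_of_mem_invariants {f : AddMonoidAlgebra F X} (hf : f ∈ invariants P F)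
    (w : P.weylGroup) (x : X) : f.coeff (w • x) = f.coeff x := by
  conv_lhs => rw [← (mem_invariants P F).1 hf w]
  exact coeff_weylAct w f x

theorem finite_orbit (x : X) : (MulAction.orbit P.weylGroup x).Finite :=
  Set.finite_range fun g : P.weylGroup => g • x

theorem orbitSum_eq_sum (x : X) : orbitSum P F x =
    ∑ l ∈ (finite_orbit (P := P) x).toFinset, AddMonoidAlgebra.single l (1 : F) :=
  finsum_mem_eq_finite_toFinset_sum _ _

theorem orbitSum_of_forall_smul_eq {x : X} (hx : ∀ w : P.weylGroup, w • x = x) :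
    orbitSum P F x = AddMonoidAlgebra.single x 1 := by
  rw [orbitSum, show MulAction.orbit P.weylGroup x = {x} from ?_, finsum_mem_singleton]
  refine Set.eq_singleton_iff_unique_mem.2 ⟨MulAction.mem_orbit_self x, ?_⟩
  rintro _ ⟨g, rfl⟩
  exact hx g

variable [P.IsReduced] {b : P.Base}

theorem isLeading_orbitSum {x : X} (hx : IsDominantChar b x) :
    IsLeading (heightHom b) (orbitSum P F x) x := by
  classical
  have key (y : X) : (orbitSum P F x).coeff y =
      if y ∈ MulAction.orbit P.weylGroup x then 1 else 0 := by
    rw [orbitSum_eq_sum, AddMonoidAlgebra.coeff_sum, Finsupp.finsetSum_apply]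
    simp [Finsupp.single_apply]
  refine ⟨by simp [key], fun y hy => ?_⟩
  rw [key, ite_ne_right_iff] at hy
  obtain ⟨⟨w, rfl⟩, -⟩ := hy
  exact or_iff_not_imp_left.2 fun hne => hx.heightHom_smul_lt b hne

variable {κ : Type*} {w : Module.Basis (b.support ⊕ κ) ℤ X}

theorem IsWeightBasis.isDominantChar_inl (hw : IsWeightBasis b w) (j : b.support) :
    IsDominantChar b (w (.inl j)) := fun i => by
  classical
  rw [hw.inl, Finsupp.single_apply]; split_ifs <;> simp

theorem IsWeightBasis.smul_inr (hw : IsWeightBasis b w) (k : κ) (g : P.weylGroup) :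
    g • w (.inr k) = w (.inr k) :=
  smul_eq_self_of_pairing_eq_zero (hw.inr k) g

theorem single_mem_invariants {x : X} (hx : ∀ g : P.weylGroup, g • x = x) :
    AddMonoidAlgebra.single x (1 : F) ∈ invariants P F :=
  (mem_invariants P F).2 fun g => by simp [weylAct, hx]

/-- The unit `e^x` of the ring of invariants, for a Weyl group invariant character `x`. -/
def singleUnit (F : Type*) [Field F] (x : X) (hx : ∀ g : P.weylGroup, g • x = x) :
    (invariants P F)ˣ where
  val := ⟨AddMonoidAlgebra.single x 1, single_mem_invariants hx⟩
  inv := ⟨AddMonoidAlgebra.single (-x) 1, single_mem_invariants fun g => by rw [smul_neg, hx]⟩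
  val_inv := Subtype.ext (by simp [AddMonoidAlgebra.single_mul_single, AddMonoidAlgebra.one_def])
  inv_val := Subtype.ext (by simp [AddMonoidAlgebra.single_mul_single, AddMonoidAlgebra.one_def])

theorem coe_singleUnit_zpow (x : X) (hx : ∀ g : P.weylGroup, g • x = x) (n : ℤ) :
    (((singleUnit F x hx ^ n : (invariants P F)ˣ) : invariants P F) : AddMonoidAlgebra F X) =
      AddMonoidAlgebra.single (n • x) 1 := by
  induction n using Int.induction_on with
  | zero => simp [AddMonoidAlgebra.one_def]
  | succ n ih =>
    rw [zpow_add_one, Units.val_mul, Subalgebra.coe_mul, ih, add_smul, one_smul]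
    simp [singleUnit, AddMonoidAlgebra.single_mul_single]
  | pred n ih =>
    rw [zpow_sub_one, Units.val_mul, Subalgebra.coe_mul, ih, sub_smul, one_smul, sub_eq_add_neg]
    simp [singleUnit, AddMonoidAlgebra.single_mul_single]

variable [Fintype κ]

variable (F) in
/-- The monomials in the coordinates, those orthogonal to the coroots being inverted. -/
def monomialHom (hw : IsWeightBasis b w) :
    Multiplicative ((b.support → ℕ) × (κ → ℤ)) →* invariants P F where
  toFun p := (∏ j, (⟨orbitSum P F (w (.inl j)), orbitSum_mem P F _⟩ : invariants P F) ^
      (p.toAdd.1 j)) * ∏ k, ((singleUnit F (w (.inr k)) (hw.smul_inr k) ^ (p.toAdd.2 k) :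
        (invariants P F)ˣ) : invariants P F)
  map_one' := by simp
  map_mul' p q := by
    simp only [toAdd_mul, Prod.fst_add, Pi.add_apply, pow_add, Finset.prod_mul_distrib,
      Prod.snd_add, zpow_add, Units.val_mul]
    ring

/-- The character of the leading term of a monomial. -/
def monomialWeight (w : Module.Basis (b.support ⊕ κ) ℤ X) (p : (b.support → ℕ) × (κ → ℤ)) : X :=
  ∑ j, p.1 j • w (.inl j) + ∑ k, p.2 k • w (.inr k)

theorem repr_monomialWeight (p : (b.support → ℕ) × (κ → ℤ)) :
    (∀ j, w.repr (monomialWeight w p) (.inl j) = p.1 j) ∧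
      ∀ k, w.repr (monomialWeight w p) (.inr k) = p.2 k := by
  classical
  constructor <;> intro <;> simp [monomialWeight, Finsupp.single_apply]

theorem monomialWeight_injective : Function.Injective (monomialWeight (P := P) (b := b) w) := by
  intro p q h
  refine Prod.ext (funext fun j => ?_) (funext fun k => ?_)
  · have := (repr_monomialWeight (w := w) p).1 j
    rw [h, (repr_monomialWeight q).1] at this
    exact_mod_cast this.symm
  · rw [← (repr_monomialWeight (w := w) p).2 k, h, (repr_monomialWeight q).2]

theorem exists_monomialWeight_eq (hw : IsWeightBasis b w) {x : X} (hx : IsDominantChar b x) :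
    ∃ p, monomialWeight w p = x := by
  refine ⟨(fun j => (P.toLinearMap x (P.coroot j)).toNat, fun k => w.repr x (.inr k)), ?_⟩
  refine w.repr.injective (Finsupp.ext fun i => ?_)
  rcases i with j | k
  · rw [(repr_monomialWeight _).1, hw.repr_inl, Int.toNat_of_nonneg (hx j)]
  · rw [(repr_monomialWeight _).2]

theorem isLeading_monomialHom (hw : IsWeightBasis b w) (p : (b.support → ℕ) × (κ → ℤ)) :
    IsLeading (heightHom b) (monomialHom F hw (.ofAdd p) : AddMonoidAlgebra F X)
      (monomialWeight w p) := by
  have : (monomialHom F hw (.ofAdd p) : AddMonoidAlgebra F X) =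
      (∏ j, orbitSum P F (w (.inl j)) ^ p.1 j) *
        ∏ k, AddMonoidAlgebra.single (p.2 k • w (.inr k)) 1 := by
    simp [monomialHom, coe_singleUnit_zpow]
  rw [this]
  exact (IsLeading.prod _ fun j _ => (isLeading_orbitSum (hw.isDominantChar_inl j)).pow _).mul
    (IsLeading.prod _ fun k _ => isLeading_single _)

variable (F) in
/-- The homomorphism to the ring of invariants from the algebra of the monoid of monomials. -/
def monomialAlgHom (hw : IsWeightBasis b w) :
    AddMonoidAlgebra F ((b.support → ℕ) × (κ → ℤ)) →ₐ[F] invariants P F :=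
  AddMonoidAlgebra.lift F (invariants P F) _ (monomialHom F hw)

theorem coeff_monomialAlgHom (hw : IsWeightBasis b w)
    (f : AddMonoidAlgebra F ((b.support → ℕ) × (κ → ℤ))) (x : X) :
    (monomialAlgHom F hw f : AddMonoidAlgebra F X).coeff x =
      ∑ p ∈ f.coeff.support, f.coeff p *
        (monomialHom F hw (.ofAdd p) : AddMonoidAlgebra F X).coeff x := by
  rw [monomialAlgHom, AddMonoidAlgebra.lift_apply, Finsupp.sum]
  simp [AddMonoidAlgebra.coeff_sum, Finsupp.finsetSum_apply]

/-- Distinct monomials have distinct leading characters. Taking a monomial of `f` whose leading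
character has maximal height, no other monomial of `f` can cancel its coefficient there. -/
theorem monomialAlgHom_injective (hw : IsWeightBasis b w) :
    Function.Injective (monomialAlgHom F hw) := by
  refine (injective_iff_map_eq_zero _).2 fun f hf => ?_
  by_contra hne
  have hne' : f.coeff.support.Nonempty := by
    rw [Finsupp.support_nonempty_iff]
    simpa using hne
  obtain ⟨p, hp, hmax⟩ := f.coeff.support.exists_max_image
    (fun p => heightHom b (monomialWeight w p)) hne'
  have h0 := coeff_monomialAlgHom hw f (monomialWeight w p)
  rw [hf, Finset.sum_eq_single p, (isLeading_monomialHom hw p).1] at h0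
  · rw [Finsupp.mem_support_iff] at hp
    exact hp (by simpa using h0.symm)
  · intro q hq hqp
    by_contra hcon
    rcases (isLeading_monomialHom hw q).2 _ (right_ne_zero_of_mul hcon) with h | h
    · exact hqp (monomialWeight_injective h).symm
    · exact (hmax q hq).not_gt h
  · exact fun h => absurd hp h

/-- Induction on a strict bound for the heights occurring in `f`: all dominant characters of top
height are removed at once by subtracting the monomials they lead. -/
theorem mem_range_monomialAlgHom (hw : IsWeightBasis b w) (N : ℕ) (f : invariants P F)
    (hf : ∀ x, (f : AddMonoidAlgebra F X).coeff x ≠ 0 → heightHom b x < N) :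
    f ∈ (monomialAlgHom F hw).range := by
  classical
  induction N generalizing f with
  | zero =>
    -- With all heights negative, `f` must vanish: a character of `f` has a dominant conjugate, also
    -- occurring in `f`, of non-negative height.
    convert zero_mem (monomialAlgHom F hw).range
    refine Subtype.ext (AddMonoidAlgebra.coeff_injective (Finsupp.ext fun x => ?_))
    by_contra hx
    obtain ⟨g, hg⟩ := exists_smul_isDominantChar b x
    have h1 := hf (g • x) (by rwa [coeff_smul_of_mem_invariants f.2])
    have h2 := heightHom_nonneg b hg
    lia
  | succ N ih =>
    obtain ⟨s, hs⟩ : ∃ s : Finset ((b.support → ℕ) × (κ → ℤ)), ∀ p, p ∈ s ↔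
        (f : AddMonoidAlgebra F X).coeff (monomialWeight w p) ≠ 0 ∧
          heightHom b (monomialWeight w p) = N := by
      refine ⟨((f : AddMonoidAlgebra F X).coeff.support.preimage (monomialWeight w)
        monomialWeight_injective.injOn).filter fun p => heightHom b (monomialWeight w p) = N,
        fun p => by simp⟩
    set g : invariants P F :=
      ∑ p ∈ s, (f : AddMonoidAlgebra F X).coeff (monomialWeight w p) • monomialHom F hw (.ofAdd p)
      with hg
    have hgr : g ∈ (monomialAlgHom F hw).range := by
      refine Subalgebra.sum_mem _ fun p _ => Subalgebra.smul_mem _ ?_ _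
      exact ⟨AddMonoidAlgebra.single p 1, by simp [monomialAlgHom]⟩
    have hgc (x : X) : (g : AddMonoidAlgebra F X).coeff x = ∑ p ∈ s,
        (f : AddMonoidAlgebra F X).coeff (monomialWeight w p) *
          (monomialHom F hw (.ofAdd p) : AddMonoidAlgebra F X).coeff x := by
      rw [hg]
      simp [AddMonoidAlgebra.coeff_sum, Finsupp.finsetSum_apply]
    rw [← sub_add_cancel f g]
    refine add_mem (ih (f - g) fun x hx => ?_) hgr
    by_contra! hN
    have hsub : ((f - g : invariants P F) : AddMonoidAlgebra F X).coeff x =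
      (f : AddMonoidAlgebra F X).coeff x - (g : AddMonoidAlgebra F X).coeff x := by simp
    have hle (y : X) (hy : ((f - g : invariants P F) : AddMonoidAlgebra F X).coeff y ≠ 0) :
        heightHom b y ≤ N := by
      by_contra! hy'
      apply hy
      have h1 : (f : AddMonoidAlgebra F X).coeff y = 0 := by
        by_contra h1
        have := hf y h1
        push_cast at this
        lia
      have h2 : (g : AddMonoidAlgebra F X).coeff y = 0 := by
        rw [hgc]
        refine Finset.sum_eq_zero fun p hp => ?_
        by_contra hcon
        have := ((hs p).1 hp).2
        rcases (isLeading_monomialHom hw p).2 _ (right_ne_zero_of_mul hcon) with h | h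
        · rw [← h] at this; lia
        · lia
      simp [h1, h2]
    have hxN := le_antisymm (hle x hx) hN
    -- A non-dominant character would have a conjugate of height above `N` in `f - g`, with the same
    -- coefficient.
    have hdom : IsDominantChar b x := by
      obtain ⟨u, hu⟩ := exists_smul_isDominantChar b x
      by_contra hnd
      have hne : u⁻¹ • (u • x) ≠ u • x := by
        rw [inv_smul_smul]
        exact fun h => hnd (h ▸ hu)
      have h1 := hu.heightHom_smul_lt b hne
      rw [inv_smul_smul] at h1
      have h2 := hle (u • x) (by rwa [coeff_smul_of_mem_invariants (f - g).2])
      lia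
    obtain ⟨p, rfl⟩ := exists_monomialWeight_eq hw hdom
    apply hx
    rw [hsub, hgc, sub_eq_zero]
    have hoff : ∀ q ∈ s, q ≠ p → (f : AddMonoidAlgebra F X).coeff (monomialWeight w q) *
        (monomialHom F hw (.ofAdd q) : AddMonoidAlgebra F X).coeff (monomialWeight w p) = 0 := by
      intro q hq hqp
      by_contra hcon
      have := ((hs q).1 hq).2
      rcases (isLeading_monomialHom hw q).2 _ (right_ne_zero_of_mul hcon) with h | h
      · exact hqp (monomialWeight_injective h).symm
      · lia
    by_cases hp : p ∈ s
    · rw [Finset.sum_eq_single_of_mem p hp hoff, (isLeading_monomialHom hw p).1, mul_one]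
    · rw [Finset.sum_eq_zero fun q hq => hoff q hq fun h => hp (h ▸ hq)]
      by_contra h
      exact hp ((hs p).2 ⟨h, hxN⟩)

theorem monomialAlgHom_bijective (hw : IsWeightBasis b w) :
    Function.Bijective (monomialAlgHom F hw) := by
  refine ⟨monomialAlgHom_injective hw, fun f => ?_⟩
  obtain ⟨N, hN⟩ : ∃ N : ℕ, ∀ x ∈ (f : AddMonoidAlgebra F X).coeff.support,
      (heightHom b x).toNat ≤ N :=
    ⟨_, fun x hx => Finset.le_sup (f := fun x => (heightHom b x).toNat) hx⟩
  refine mem_range_monomialAlgHom hw (N + 1) f fun x hx => ?_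
  have := hN x (Finsupp.mem_support_iff.2 hx)
  lia

theorem IsWeightBasis.coords_inr (hw : IsWeightBasis b w) (c : AdjQuotient P F F) (k : κ) :
    coords P F w c (.inr k) = c (singleUnit F (w (.inr k)) (hw.smul_inr k)).val := by
  simp only [coords, orbitSum_of_forall_smul_eq (hw.smul_inr k)]
  rfl

theorem apply_monomialHom (hw : IsWeightBasis b w) (c : AdjQuotient P F F)
    (p : (b.support → ℕ) × (κ → ℤ)) : c (monomialHom F hw (.ofAdd p)) =
      (∏ j, coords P F w c (.inl j) ^ p.1 j) * ∏ k, coords P F w c (.inr k) ^ p.2 k := by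
  have h (u : (invariants P F)ˣ) (n : ℤ) : c ((u ^ n : (invariants P F)ˣ) : invariants P F) =
      c u ^ n := by
    change _ = ((Units.map (c : invariants P F →* F) u : Fˣ) : F) ^ n
    rw [← Units.val_zpow_eq_zpow_val (Units.map (c : invariants P F →* F) u) n, ← map_zpow]
    rfl
  simp only [monomialHom, MonoidHom.coe_mk, OneHom.coe_mk, map_mul, map_prod, map_pow, h,
    hw.coords_inr]
  rfl

/-- A point is determined by its values on monomials. Conversely a tuple with invertible central
entries defines a multiplicative map on the monoid of exponents, hence a point through the inverse
of `monomialAlgHom`. -/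
theorem bijOn_coords (hw : IsWeightBasis b w) :
    Set.BijOn (coords P F w) Set.univ {t | ∀ k : κ, t (Sum.inr k) ≠ 0} := by
  refine ⟨fun c _ k => ?_, fun c _ c' _ h => ?_, fun t ht => ?_⟩
  · rw [hw.coords_inr]
    exact ((singleUnit F (w (.inr k)) (hw.smul_inr k)).isUnit.map c).ne_zero
  · have : c.comp (monomialAlgHom F hw) = c'.comp (monomialAlgHom F hw) := by
      refine AddMonoidAlgebra.algHom_ext (fun p => ?_) (by ext)
      simp [monomialAlgHom, apply_monomialHom, h]
    ext f
    obtain ⟨g, rfl⟩ := (monomialAlgHom_bijective hw).2 f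
    exact DFunLike.congr_fun this g
  · let φ : Multiplicative ((b.support → ℕ) × (κ → ℤ)) →* F :=
      { toFun := fun p => (∏ j, t (.inl j) ^ p.toAdd.1 j) * ∏ k, t (.inr k) ^ p.toAdd.2 k
        map_one' := by simp
        map_mul' := fun p q => by
          simp only [toAdd_mul, Prod.fst_add, Pi.add_apply, pow_add, Finset.prod_mul_distrib,
            Prod.snd_add, zpow_add₀ (ht _)]
          ring }
    let e := AlgEquiv.ofBijective _ (monomialAlgHom_bijective (F := F) hw)
    let c : AdjQuotient P F F := (AddMonoidAlgebra.lift F F _ φ).comp e.symm.toAlgHom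
    have hc (p : (b.support → ℕ) × (κ → ℤ)) : c (monomialHom F hw (.ofAdd p)) = φ (.ofAdd p) := by
      have : e.symm (monomialHom F hw (.ofAdd p)) = AddMonoidAlgebra.single p 1 := by
        rw [AlgEquiv.symm_apply_eq]
        simp [e, monomialAlgHom]
      simp [c, this]
    classical
    refine ⟨c, trivial, funext fun i => ?_⟩
    simp only [apply_monomialHom] at hc
    rcases i with j | k
    · have := hc (Pi.single j 1, 0)
      simpa [φ, Pi.single_apply, pow_ite] using this
    · have := hc (0, Pi.single k 1)
      simpa [φ, Pi.single_apply] using this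

end Invariants

/-! ### Lifting points along the quotient map. -/

/-- Lying over gives a prime `Q` of `S` above `ker f`; the domain `S ⧸ Q` is algebraic over `R ⧸ ker
f`, so it maps to the algebraically closed `K`. -/
theorem exists_ringHom_comp_algebraMap_eq {R S K : Type*} [CommRing R] [CommRing S] [Algebra R S]
    [Algebra.IsIntegral R S] [FaithfulSMul R S] [Field K] [IsAlgClosed K] (f : R →+* K) :
    ∃ g : S →+* K, g.comp (algebraMap R S) = f := by
  have := RingHom.ker_isPrime f
  obtain ⟨Q, hQ, hQ'⟩ := Ideal.nonempty_primesOver (S := S) (RingHom.ker f)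
  let := (RingHom.kerLift f).toAlgebra
  have : Module.IsTorsionFree (R ⧸ RingHom.ker f) K :=
    Module.isTorsionFree_iff_algebraMap_injective.2 (RingHom.kerLift_injective f)
  have : Module.IsTorsionFree (R ⧸ RingHom.ker f) (S ⧸ Q) := by
    refine Module.isTorsionFree_iff_algebraMap_injective.2 ?_
    exact FaithfulSMul.algebraMap_injective _ _
  let φ : S ⧸ Q →ₐ[R ⧸ RingHom.ker f] K := IsAlgClosed.lift
  refine ⟨φ.toRingHom.comp (Ideal.Quotient.mk Q), RingHom.ext fun r => ?_⟩
  exact φ.commutes (Ideal.Quotient.mk _ r)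

section Quotient

variable {ι X Y : Type*} [AddCommGroup X] [AddCommGroup Y] {P : RootPairing ι ℤ X Y}
variable {F : Type*} [Field F]

theorem weylAct_mul (g h : P.weylGroup) (f : AddMonoidAlgebra F X) :
    weylAct P F (g * h) f = weylAct P F g (weylAct P F h f) := by
  have : (weylAct P F (g * h)).toAlgHom =
      (weylAct P F g).toAlgHom.comp (weylAct P F h).toAlgHom :=
    AddMonoidAlgebra.algHom_ext (fun x => by simp [weylAct, mul_smul]) (by ext)
  exact DFunLike.congr_fun this f

theorem weylAct_one (f : AddMonoidAlgebra F X) : weylAct P F 1 f = f := by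
  have : (weylAct P F 1).toAlgHom = AlgHom.id F _ :=
    AddMonoidAlgebra.algHom_ext (fun x => by simp [weylAct]) (by ext)
  exact DFunLike.congr_fun this f

instance isIntegral_invariants [Finite ι] :
    Algebra.IsIntegral (invariants P F) (AddMonoidAlgebra F X) := by
  let : MulSemiringAction P.weylGroup (AddMonoidAlgebra F X) :=
    { smul := fun g f => weylAct P F g f
      one_smul := weylAct_one
      mul_smul := weylAct_mul
      smul_zero := fun g => map_zero (weylAct P F g)
      smul_add := fun g => map_add (weylAct P F g)
      smul_one := fun g => map_one (weylAct P F g)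
      smul_mul := fun g => map_mul (weylAct P F g) }
  have : Algebra.IsInvariant (invariants P F) (AddMonoidAlgebra F X) P.weylGroup :=
    ⟨fun f hf => ⟨⟨f, (mem_invariants P F).2 hf⟩, rfl⟩⟩
  have : SMulCommClass P.weylGroup (invariants P F) (AddMonoidAlgebra F X) := by
    refine ⟨fun g r f => ?_⟩
    change weylAct P F g ((r : AddMonoidAlgebra F X) * f) =
      (r : AddMonoidAlgebra F X) * weylAct P F g f
    rw [map_mul, (mem_invariants P F).1 r.2]
  exact Algebra.IsInvariant.isIntegral _ _ P.weylGroup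

variable {K : Type*} [Field K] [Algebra F K]

theorem exists_quotientMap_eq [Finite ι] [IsAlgClosed K] (c : AdjQuotient P F K) :
    ∃ a : AddMonoidAlgebra F X →ₐ[F] K, quotientMap P F a = c := by
  have : FaithfulSMul (invariants P F) (AddMonoidAlgebra F X) :=
    (faithfulSMul_iff_algebraMap_injective _ _).2 Subtype.val_injective
  obtain ⟨g, hg⟩ := exists_ringHom_comp_algebraMap_eq (S := AddMonoidAlgebra F X) (c : invariants P F →+* K)
  have hg' (r : invariants P F) : g r = c r := RingHom.congr_fun hg r
  refine ⟨{ g with commutes' := fun r => ?_ }, AlgHom.ext hg'⟩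
  simpa using hg' (algebraMap F _ r)

theorem quotientMap_comp_weylAct (a : AddMonoidAlgebra F X →ₐ[F] K) (g : P.weylGroup) :
    quotientMap P F (a.comp (weylAct P F g : AddMonoidAlgebra F X →ₐ[F] _)) =
      quotientMap P F a := by
  ext f
  exact congrArg a ((mem_invariants P F).1 f.2 g)

end Quotient

/-! ### Closest dominant points and their extension to infinite coordinates. -/

/-- Projections onto closed convex sets can be taken in the Euclidean model, so that `𝔞` keeps its
topology of pointwise convergence and receives no competing norm. -/
theorem exists_linearEquiv_euclideanSpace {V : Type*} [AddCommGroup V] [Module ℝ V]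
    [FiniteDimensional ℝ V] (B : LinearMap.BilinForm ℝ V) (hs : ∀ x y, B x y = B y x)
    (hp : ∀ x, x ≠ 0 → 0 < B x x) :
    ∃ (n : ℕ) (e : V ≃ₗ[ℝ] EuclideanSpace ℝ (Fin n)), ∀ x y, inner ℝ (e x) (e y) = B x y := by
  let core : InnerProductSpace.Core ℝ V :=
    { inner := fun x y => B x y
      conj_inner_symm := fun x y => hs y x
      re_inner_nonneg := fun x => by
        by_cases hx : x = 0
        · simp [hx]
        · exact (hp x hx).le
      add_left := fun x y z => by simp
      smul_left := fun x y r => by simp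
      definite := fun x hx => by
        by_contra h
        exact (hp x h).ne' hx }
  let : NormedAddCommGroup V := core.toNormedAddCommGroup
  let : InnerProductSpace ℝ V := InnerProductSpace.ofCore core.toCore
  exact ⟨_, (stdOrthonormalBasis ℝ V).repr.toLinearEquiv,
    fun x y => (stdOrthonormalBasis ℝ V).repr.inner_map_map x y⟩

section Cone

variable {ι X Y : Type*} [AddCommGroup X] [AddCommGroup Y] {P : RootPairing ι ℤ X Y}

theorem toCochar_apply (y : Y) (x : X) : toCochar P y x = (P.toLinearMap x y : ℝ) := rfl

/-- Evaluation of points of `𝔞` at a character. -/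
def evalLinear (l : X) : Cochar X →ₗ[ℝ] ℝ where
  toFun x := x l
  map_add' _ _ := rfl
  map_smul' _ _ := rfl

@[simp]
theorem evalLinear_apply (l : X) (x : Cochar X) : evalLinear l x = x l := rfl

/-- The translate of a point of `𝔞` by an element of the Weyl group. -/
def weylTranslate (g : P.weylGroup) (x : Cochar X) : Cochar X :=
  (x.toAddMonoidHom.comp (DistribSMul.toAddMonoidHom X g⁻¹)).toIntLinearMap

theorem weylTranslate_apply (g : P.weylGroup) (x : Cochar X) (l : X) :
    weylTranslate g x l = x (g⁻¹ • l) := rfl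

theorem mem_weylOrbit_iff {x y : Cochar X} :
    y ∈ weylOrbit P x ↔ ∃ g : P.weylGroup, y = weylTranslate g x :=
  exists_congr fun _ => ⟨fun h => LinearMap.ext h, fun h _ => h ▸ rfl⟩

theorem ofIdx_inv (i : ι) : (weylGroup.ofIdx P i)⁻¹ = weylGroup.ofIdx P i :=
  inv_eq_of_mul_eq_one_left (ofIdx_mul_self i)

variable {B : LinearMap.BilinForm ℝ (Cochar X)}

/-- Invariance under `s_i`, which negates the coroot and sends `z` to `z - z(α_i) α_i^∨`. Thus
`B(α_i^∨, z)` has the sign of `z(α_i)`. -/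
theorem IsInvariantInner.two_mul_apply_coroot (hB : IsInvariantInner P B) (i : ι)
    (z : Cochar X) :
    2 * B (toCochar P (P.coroot i)) z =
      B (toCochar P (P.coroot i)) (toCochar P (P.coroot i)) * z (P.root i) := by
  have h := hB.invariant (weylGroup.ofIdx P i) (toCochar P (P.coroot i)) z
    (-toCochar P (P.coroot i)) (z - z (P.root i) • toCochar P (P.coroot i)) ?_ ?_
  · simp only [map_neg, LinearMap.neg_apply, map_sub, map_smul, smul_eq_mul] at h
    linarith
  · intro l
    rw [ofIdx_inv, smul_eq_reflection, P.reflection_apply, map_sub, LinearMap.neg_apply, map_zsmul]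
    simp only [toCochar_apply, coroot', LinearMap.flip_apply, root_coroot_two]
    simp
    ring
  · intro l
    rw [ofIdx_inv, smul_eq_reflection, P.reflection_apply, map_sub, map_zsmul, LinearMap.sub_apply,
      LinearMap.smul_apply, toCochar_apply]
    simp [coroot', mul_comm]

theorem IsInvariantInner.self_nonneg (hB : IsInvariantInner P B) (x : Cochar X) : 0 ≤ B x x := by
  by_cases hx : x = 0
  · simp [hx]
  · exact (hB.pos x hx).le

variable {b : P.Base}

theorem convex_image_isDominant {V : Type*} [AddCommGroup V] [Module ℝ V] (e : Cochar X ≃ₗ[ℝ] V) :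
    Convex ℝ (e '' {x | IsDominant P b x}) := by
  refine Convex.linear_image (s := {x | IsDominant P b x}) ?_ e.toLinearMap
  intro x hx y hy s t hs ht _ i
  exact add_nonneg (mul_nonneg hs (hx i)) (mul_nonneg ht (hy i))

theorem IsClosestDominant.apply_sub_nonpos [FiniteDimensional ℝ (Cochar X)]
    (hB : IsInvariantInner P B) {x y z : Cochar X} (h : IsClosestDominant P b B x y)
    (hz : IsDominant P b z) : B (x - y) (z - y) ≤ 0 := by
  obtain ⟨n, e, he⟩ := exists_linearEquiv_euclideanSpace B hB.symm hB.pos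
  have hy : e y ∈ e '' {x | IsDominant P b x} := ⟨y, h.1, rfl⟩
  have key := (norm_eq_iInf_iff_real_inner_le_zero (convex_image_isDominant e) hy (u := e x)).1 ?_
    (e z) ⟨z, hz, rfl⟩
  · rwa [← map_sub, ← map_sub, he] at key
  · have : Nonempty (e '' {x | IsDominant P b x}) := ⟨⟨_, hy⟩⟩
    refine le_antisymm (le_ciInf ?_) ?_
    · rintro ⟨_, t, ht, rfl⟩
      rw [← sq_le_sq₀ (norm_nonneg _) (norm_nonneg _), ← real_inner_self_eq_norm_sq,
        ← real_inner_self_eq_norm_sq]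
      simp only [← map_sub, he]
      exact h.2 t ht
    · exact ciInf_le ⟨0, by rintro _ ⟨_, rfl⟩; exact norm_nonneg _⟩
        (⟨e y, hy⟩ : e '' {x | IsDominant P b x})

theorem isClosestDominant_closest [FiniteDimensional ℝ (Cochar X)] (hB : IsInvariantInner P B)
    (x : Cochar X) : IsClosestDominant P b B x (closest P b B x) := by
  refine Classical.epsilon_spec ?_
  obtain ⟨n, e, he⟩ := exists_linearEquiv_euclideanSpace B hB.symm hB.pos
  have hc : IsClosed (e '' {x | IsDominant P b x}) := by
    have : e '' {x | IsDominant P b x} =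
        ⋂ i : b.support, {u | 0 ≤ (evalLinear (P.root i) ∘ₗ e.symm.toLinearMap) u} := by
      ext u
      rw [Set.mem_iInter]
      exact ⟨by rintro ⟨x, hx, rfl⟩ i; simpa using hx i, fun h => ⟨e.symm u, h, by simp⟩⟩
    rw [this]
    exact isClosed_iInter fun i => isClosed_le continuous_const
      (LinearMap.continuous_of_finiteDimensional _)
  obtain ⟨v, ⟨y, hy, rfl⟩, hv⟩ := exists_norm_eq_iInf_of_complete_convex
    (K := e '' {x | IsDominant P b x}) ⟨_, 0, fun i => le_rfl, rfl⟩ hc.isComplete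
    (convex_image_isDominant e) (e x)
  refine ⟨y, hy, fun z hz => ?_⟩
  have h : ‖e x - e y‖ ≤ ‖e x - e z‖ := by
    rw [hv]
    exact ciInf_le ⟨0, by rintro _ ⟨_, rfl⟩; exact norm_nonneg _⟩
      (⟨e z, z, hz, rfl⟩ : e '' {x | IsDominant P b x})
  rwa [← sq_le_sq₀ (norm_nonneg _) (norm_nonneg _), ← real_inner_self_eq_norm_sq,
    ← real_inner_self_eq_norm_sq, ← map_sub, ← map_sub, he, he] at h

/-- Points of a convex set with the variational property of closest points depend on the
given points in a non-expansive way. -/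
theorem IsInvariantInner.apply_sub_le (hB : IsInvariantInner P B) {x x' y y' : Cochar X}
    (h : B (x - y) (y' - y) ≤ 0) (h' : B (x' - y') (y - y') ≤ 0) :
    B (y - y') (y - y') ≤ B (x - x') (x - x') := by
  have h1 := hB.self_nonneg ((x - x') - (y - y'))
  simp only [map_sub, LinearMap.sub_apply] at h h' h1 ⊢
  linarith [hB.symm x y, hB.symm x y', hB.symm x' y, hB.symm x' y', hB.symm y y', hB.symm x x']

variable {κ : Type*} {w : Module.Basis (b.support ⊕ κ) ℤ X}

theorem IsWeightBasis.finiteDimensional [Finite κ] (w : Module.Basis (b.support ⊕ κ) ℤ X) :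
    FiniteDimensional ℝ (Cochar X) :=
  Module.Finite.equiv (w.constr ℝ : (b.support ⊕ κ → ℝ) ≃ₗ[ℝ] Cochar X)

theorem IsWeightBasis.simpleCoroot_inl (hw : IsWeightBasis b w) (i j : b.support) :
    simpleCoroot P b i (w (.inl j)) = Finsupp.single i (1 : ℝ) j := by
  classical
  rw [simpleCoroot, toCochar_apply, hw.inl, Finsupp.single_apply, Finsupp.single_apply]
  simp [eq_comm]

theorem IsWeightBasis.simpleCoroot_inr (hw : IsWeightBasis b w) (i : b.support) (k : κ) :
    simpleCoroot P b i (w (.inr k)) = 0 := by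
  rw [simpleCoroot, toCochar_apply, hw.inr, Int.cast_zero]

theorem IsWeightBasis.sum_smul_simpleCoroot_inl (hw : IsWeightBasis b w) (t : b.support → ℝ)
    (j : b.support) : (∑ i, t i • simpleCoroot P b i) (w (.inl j)) = t j := by
  classical simp [hw.simpleCoroot_inl, Finsupp.single_apply]

theorem IsWeightBasis.sum_smul_simpleCoroot_inr (hw : IsWeightBasis b w) (t : b.support → ℝ)
    (k : κ) : (∑ i, t i • simpleCoroot P b i) (w (.inr k)) = 0 := by
  simp [hw.simpleCoroot_inr]

theorem IsWeightBasis.eq_sum_smul_simpleCoroot (hw : IsWeightBasis b w) {x : Cochar X}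
    (hx : ∀ k, x (w (.inr k)) = 0) : x = ∑ i, x (w (.inl i)) • simpleCoroot P b i := by
  refine w.ext fun i => ?_
  rcases i with j | k
  · rw [hw.sum_smul_simpleCoroot_inl]
  · rw [hw.sum_smul_simpleCoroot_inr, hx]

/-- The coefficients of a combination of simple coroots are its values at the fundamental weights,
and its central values vanish. -/
theorem IsWeightBasis.domLE_iff (hw : IsWeightBasis b w) {x y : Cochar X} : DomLE P b x y ↔
    (∀ j, x (w (.inl j)) ≤ y (w (.inl j))) ∧ ∀ k, x (w (.inr k)) = y (w (.inr k)) := by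
  constructor
  · rintro ⟨t, ht, h⟩
    refine ⟨fun j => ?_, fun k => ?_⟩
    · have := hw.sum_smul_simpleCoroot_inl t j
      rw [← h, LinearMap.sub_apply] at this
      linarith [ht j]
    · have := hw.sum_smul_simpleCoroot_inr t k
      rw [← h, LinearMap.sub_apply] at this
      linarith
  · rintro ⟨h1, h2⟩
    exact ⟨_, fun j => sub_nonneg.2 (h1 j),
      hw.eq_sum_smul_simpleCoroot (x := y - x) fun k => by simp [h2]⟩

/-- The dominant point `μ` satisfies the inequalities and equalities in terms of the extended
coordinates `d` which characterize the points closest to `d`. -/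
structure Fits (w : Module.Basis (b.support ⊕ κ) ℤ X) (d : b.support ⊕ κ → EReal)
    (μ : Cochar X) : Prop where
  isDominant : IsDominant P b μ
  le : ∀ j, d (.inl j) ≤ (μ (w (.inl j)) : ℝ)
  eq : ∀ j : b.support, μ (P.root j) ≠ 0 → d (.inl j) = (μ (w (.inl j)) : ℝ)
  inr : ∀ k, d (.inr k) = (μ (w (.inr k)) : ℝ)

/-- Only coroots with `⟨α_j, μ⟩ = 0` occur in `x - μ`, with coefficients at most `0`, and for these
`B(α_j^∨, z - μ)` is a non-negative multiple of `⟨α_j, z⟩ ≥ 0`. -/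
theorem Fits.apply_sub_nonpos (hw : IsWeightBasis b w) (hB : IsInvariantInner P B)
    {x μ z : Cochar X} (h : Fits w (cocharCoords w x) μ) (hz : IsDominant P b z) :
    B (x - μ) (z - μ) ≤ 0 := by
  rw [hw.eq_sum_smul_simpleCoroot (x := x - μ) fun k => ?_, map_sum, LinearMap.sum_apply]
  · refine Finset.sum_nonpos fun j _ => ?_
    have h1 : x (w (.inl j)) ≤ μ (w (.inl j)) := EReal.coe_le_coe_iff.1 (h.le j)
    rw [map_smul, LinearMap.smul_apply, LinearMap.sub_apply, smul_eq_mul]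
    by_cases h0 : μ (P.root j) = 0
    · refine mul_nonpos_of_nonpos_of_nonneg (sub_nonpos.2 h1) ?_
      have h2 := hB.two_mul_apply_coroot (j : ι) (z - μ)
      rw [LinearMap.sub_apply, h0, sub_zero] at h2
      have h3 := mul_nonneg (hB.self_nonneg (toCochar P (P.coroot j))) (hz j)
      change 0 ≤ B (toCochar P (P.coroot j)) (z - μ)
      linarith
    · have : x (w (.inl j)) = μ (w (.inl j)) := EReal.coe_eq_coe_iff.1 (h.eq j h0)
      simp [this]
  · have : x (w (.inr k)) = μ (w (.inr k)) := EReal.coe_eq_coe_iff.1 (h.inr k)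
    simp [this]

instance : T2Space (Cochar X) :=
  T2Space.of_injective_continuous (f := fun (x : Cochar X) (l : X) => x l)
    DFunLike.coe_injective continuous_induced_dom

theorem Fits.ne_top {d : b.support ⊕ κ → EReal} {μ : Cochar X} (h : Fits w d μ)
    (i : b.support ⊕ κ) : d i ≠ ⊤ := by
  rcases i with j | k
  · exact ((h.le j).trans_lt (EReal.coe_lt_top _)).ne
  · rw [h.inr]; exact EReal.coe_ne_top _

/-- Replacing each `-∞` by `-n` approximates `d` by points of `𝔞`. Without this, limits along the
filter would not be unique. -/
theorem neBot_comap_cocharCoords [Finite κ] (w : Module.Basis (b.support ⊕ κ) ℤ X)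
    {d : b.support ⊕ κ → EReal} (hd : ∀ i, d i ≠ ⊤) :
    (comap (cocharCoords w) (𝓝 d)).NeBot := by
  classical
  have hlim : Tendsto (fun n : ℕ => cocharCoords w (w.constr ℝ fun i =>
      if d i = ⊥ then -(n : ℝ) else (d i).toReal)) atTop (𝓝 d) := by
    rw [tendsto_pi_nhds]
    intro i
    simp only [cocharCoords, Module.Basis.constr_basis]
    by_cases hi : d i = ⊥
    · simp only [hi, if_true]
      rw [EReal.nhds_bot_basis.tendsto_right_iff]
      intro r _
      obtain ⟨N, hN⟩ := exists_nat_gt (-r)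
      filter_upwards [eventually_ge_atTop N] with n hn
      have : (N : ℝ) ≤ n := by exact_mod_cast hn
      exact EReal.coe_lt_coe_iff.2 (by linarith)
    · simp only [hi, if_false, EReal.coe_toReal (hd i) hi]
      exact tendsto_const_nhds
  rw [comap_neBot_iff]
  intro t ht
  obtain ⟨n, hn⟩ := (hlim.eventually_mem ht).exists
  exact ⟨_, hn⟩

/-- A point `x` near `d` is moved to a point `x₀` that `μ` fits, by a displacement tending to `0`.
Since `μ` has the variational property for `x₀`, non-expansiveness bounds the distance from `r(x)`
to `μ` by that displacement. -/
theorem Fits.tendsto_closest [Finite κ] (hw : IsWeightBasis b w) (hB : IsInvariantInner P B)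
    {d : b.support ⊕ κ → EReal} {μ : Cochar X} (h : Fits w d μ) :
    Tendsto (closest P b B) (comap (cocharCoords w) (𝓝 d)) (𝓝 μ) := by
  classical
  have := IsWeightBasis.finiteDimensional w
  obtain ⟨n, e, he⟩ := exists_linearEquiv_euclideanSpace B hB.symm hB.pos
  set l := comap (cocharCoords w) (𝓝 d) with hl
  have hx (i : b.support ⊕ κ) : Tendsto (fun x : Cochar X => ((x (w i) : ℝ) : EReal)) l (𝓝 (d i)) :=
    (tendsto_pi_nhds.1 (tendsto_comap : Tendsto (cocharCoords w) l (𝓝 d))) i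
  -- The displacement corrects finite coordinates only. Where `d` is `-∞` the coordinate of `x` is
  -- kept, being eventually below that of `μ`.
  let δ (x : Cochar X) (i : b.support ⊕ κ) : ℝ := if d i = ⊥ then 0 else x (w i) - (d i).toReal
  have hδ : Tendsto δ l (𝓝 0) := by
    rw [tendsto_pi_nhds]
    intro i
    by_cases hi : d i = ⊥
    · simp only [δ, hi, if_true]
      exact tendsto_const_nhds
    · simp only [δ, hi, if_false]
      have h1 : Tendsto (fun x : Cochar X => x (w i)) l (𝓝 (d i).toReal) := by
        have := (EReal.tendsto_toReal (h.ne_top i) hi).comp (hx i)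
        simpa [Function.comp_def] using this
      simpa using h1.sub_const (d i).toReal
  let L : (b.support ⊕ κ → ℝ) →ₗ[ℝ] EuclideanSpace ℝ (Fin n) :=
    e.toLinearMap ∘ₗ (w.constr ℝ : (b.support ⊕ κ → ℝ) ≃ₗ[ℝ] Cochar X).toLinearMap
  have hLδ : Tendsto (fun x => L (δ x)) l (𝓝 0) := by
    have := (L.continuous_of_finiteDimensional.tendsto 0).comp hδ
    rwa [map_zero] at this
  have hev : ∀ᶠ x in l, ∀ i : b.support ⊕ κ, d i = ⊥ → ((x (w i) : ℝ) : EReal) < (μ (w i) : ℝ) := by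
    rw [eventually_all]
    intro i
    by_cases hi : d i = ⊥
    · have := (hx i).eventually_lt_const (show d i < (μ (w i) : ℝ) by rw [hi]; exact EReal.bot_lt_coe _)
      filter_upwards [this] with x hx _ using hx
    · exact Eventually.of_forall fun x hx => absurd hx hi
  have hbound : ∀ᶠ x in l, ‖e (closest P b B x) - e μ‖ ≤ ‖L (δ x)‖ := by
    filter_upwards [hev] with x hx
    set x₀ : Cochar X := x - w.constr ℝ (δ x) with hx₀
    have hx₀i (i : b.support ⊕ κ) : x₀ (w i) = if d i = ⊥ then x (w i) else (d i).toReal := by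
      rw [hx₀, LinearMap.sub_apply, Module.Basis.constr_basis]
      simp only [δ]
      split_ifs <;> ring
    have hd (i : b.support ⊕ κ) (hi : d i ≠ ⊥) : (x₀ (w i) : EReal) = d i := by
      rw [hx₀i, if_neg hi, EReal.coe_toReal (h.ne_top i) hi]
    have hf : Fits w (cocharCoords w x₀) μ := by
      refine ⟨h.isDominant, fun j => ?_, fun j hj => ?_, fun k => ?_⟩
      · by_cases hi : d (.inl j) = ⊥
        · rw [cocharCoords, hx₀i, if_pos hi]
          exact (hx _ hi).le
        · rw [cocharCoords, hd _ hi]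
          exact h.le j
      · rw [cocharCoords, hd _ (by rw [h.eq j hj]; exact EReal.coe_ne_bot _), h.eq j hj]
      · rw [cocharCoords, hd _ (by rw [h.inr]; exact EReal.coe_ne_bot _), h.inr]
    have hcl := isClosestDominant_closest (b := b) hB x
    have := hB.apply_sub_le (hcl.apply_sub_nonpos hB h.isDominant)
      (hf.apply_sub_nonpos hw hB hcl.1)
    rw [← sq_le_sq₀ (norm_nonneg _) (norm_nonneg _), ← real_inner_self_eq_norm_sq,
      ← real_inner_self_eq_norm_sq, ← map_sub, he]
    refine this.trans_eq ?_
    rw [← he, hx₀, sub_sub_cancel]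
    rfl
  have hlim : Tendsto (fun x => e (closest P b B x)) l (𝓝 (e μ)) := by
    rw [tendsto_iff_norm_sub_tendsto_zero]
    exact squeeze_zero' (Eventually.of_forall fun _ => norm_nonneg _) hbound
      (by simpa using hLδ.norm)
  rw [nhds_induced, tendsto_comap_iff, tendsto_pi_nhds]
  intro x
  have := ((evalLinear x ∘ₗ e.symm.toLinearMap).continuous_of_finiteDimensional.tendsto
    (e μ)).comp hlim
  simpa [Function.comp_def] using this

theorem Fits.closestExt_eq [Finite κ] (hw : IsWeightBasis b w) (hB : IsInvariantInner P B)
    {d : b.support ⊕ κ → EReal} {μ : Cochar X} (h : Fits w d μ) :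
    closestExt P b B w d = μ :=
  have := neBot_comap_cocharCoords w h.ne_top
  (h.tendsto_closest hw hB).limUnder_eq

end Cone

/-! ### Dominant points of Weyl orbits in `𝔞`. -/

section Orbit

variable {ι X Y : Type*} [AddCommGroup X] [AddCommGroup Y] {P : RootPairing ι ℤ X Y} [Finite ι]
variable {b : P.Base} {κ : Type*} {w : Module.Basis (b.support ⊕ κ) ℤ X}

/-- The sum of the fundamental weights pairs to `1` with every simple coroot, so `s_i` lowers the
value of `y` at it by `⟨α_i, y⟩`. A translate maximizing this value is dominant. -/
theorem exists_weylTranslate_isDominant (hw : IsWeightBasis b w) (x : Cochar X) :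
    ∃ g : P.weylGroup, IsDominant P b (weylTranslate g x) := by
  obtain ⟨g, hg⟩ := Finite.exists_max fun g : P.weylGroup =>
    weylTranslate g x (∑ j, w (.inl j))
  refine ⟨g, fun i => ?_⟩
  have h := hg (weylGroup.ofIdx P i * g)
  have h1 : P.toLinearMap (∑ j, w (.inl j)) (P.coroot i) = 1 := by
    classical
    simp [hw.inl, Finsupp.single_apply]
  rw [weylTranslate_apply, mul_inv_rev, mul_smul, ofIdx_inv, smul_eq_reflection,
    P.reflection_apply, coroot', LinearMap.flip_apply, h1, one_smul, ← weylTranslate_apply,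
    map_sub] at h
  linarith

variable [P.IsReduced]

theorem IsDominantChar.apply_smul_le {l : X} (hl : IsDominantChar b l) (g : P.weylGroup)
    {x : Cochar X} (hx : IsDominant P b x) : x (g • l) ≤ x l := by
  obtain ⟨n, hn⟩ := hl.exists_sub_smul_eq g
  have : 0 ≤ x (l - g • l) := by
    rw [hn, map_sum]
    exact Finset.sum_nonneg fun j _ => by rw [map_nsmul]; exact nsmul_nonneg (hx j) _
  rw [map_sub] at this
  linarith

/-- Some simple root pairing positively with `ω_j` on the coroot side occurs in `ω_j - g • ω_j`.
Only `α_j` qualifies, and `x` is positive on it. -/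
theorem IsWeightBasis.apply_smul_lt (hw : IsWeightBasis b w) {j : b.support} {x : Cochar X}
    (hx : IsDominant P b x) (hj : x (P.root j) ≠ 0) {g : P.weylGroup}
    (hg : g • w (.inl j) ≠ w (.inl j)) : x (g • w (.inl j)) < x (w (.inl j)) := by
  classical
  obtain ⟨n, hn⟩ := (hw.isDominantChar_inl j).exists_sub_smul_eq g
  obtain ⟨i, hi, hi'⟩ := exists_ne_zero_of_sub_smul_eq hn hg
  obtain rfl : j = i := by
    by_contra h
    rw [hw.inl, Finsupp.single_apply, if_neg h] at hi'
    exact hi'.false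
  have : 0 < x (w (.inl j) - g • w (.inl j)) := by
    rw [hn, map_sum]
    refine Finset.sum_pos' (fun i _ => by rw [map_nsmul]; exact nsmul_nonneg (hx i) _)
      ⟨j, Finset.mem_univ _, ?_⟩
    rw [map_nsmul]
    exact nsmul_pos (lt_of_le_of_ne (hx j) hj.symm) hi
  rw [map_sub] at this
  linarith

/-- For each of the two dominant points, `ω_j` is maximal on its orbit; using this for both `g` and
`g⁻¹` gives equality. -/
theorem IsWeightBasis.weylTranslate_eq_self (hw : IsWeightBasis b w) {x : Cochar X}
    {g : P.weylGroup} (hx : IsDominant P b x) (hgx : IsDominant P b (weylTranslate g x)) :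
    weylTranslate g x = x := by
  refine w.ext fun i => ?_
  rcases i with j | k
  · have hd := hw.isDominantChar_inl j
    refine le_antisymm (hd.apply_smul_le g⁻¹ hx) ?_
    have := hd.apply_smul_le g hgx
    rwa [weylTranslate_apply, inv_smul_smul] at this
  · rw [weylTranslate_apply, smul_eq_self_of_pairing_eq_zero (hw.inr k)]

end Orbit

/-! ### Comparing fitting points in the dominance order. -/

section DominanceOrder

variable {ι X Y : Type*} [AddCommGroup X] [AddCommGroup Y] {P : RootPairing ι ℤ X Y} [Finite ι]
variable {b : P.Base} {B : LinearMap.BilinForm ℝ (Cochar X)}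

theorem IsInvariantInner.apply_simpleCoroot_nonpos (hB : IsInvariantInner P B)
    {i j : b.support} (hij : i ≠ j) : B (simpleCoroot P b i) (simpleCoroot P b j) ≤ 0 := by
  have h := hB.two_mul_apply_coroot (i : ι) (simpleCoroot P b j)
  have h1 : P.pairing i j ≤ 0 := by
    have := b.pairingIn_le_zero_of_ne (Subtype.coe_ne_coe.2 hij) i.2 j.2
    rwa [← P.algebraMap_pairingIn ℤ]
  have h2 : simpleCoroot P b j (P.root i) ≤ 0 := by
    rw [simpleCoroot, toCochar_apply]
    exact_mod_cast h1
  have := mul_nonpos_of_nonneg_of_nonpos (hB.self_nonneg (toCochar P (P.coroot i))) h2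
  change B (toCochar P (P.coroot i)) _ ≤ 0
  linarith

variable {κ : Type*} {w : Module.Basis (b.support ⊕ κ) ℤ X}

/-- If the negative coefficients of a combination of simple coroots occur only at simple roots on
which the combination is non-negative, then there are none. -/
theorem IsInvariantInner.coeff_nonneg (hw : IsWeightBasis b w) (hB : IsInvariantInner P B)
    {t : b.support → ℝ}
    (h : ∀ i : b.support, t i < 0 → 0 ≤ (∑ j, t j • simpleCoroot P b j) (P.root i))
    (i : b.support) : 0 ≤ t i := by
  obtain ⟨x, hx⟩ : ∃ x, x = ∑ j, t j • simpleCoroot P b j := ⟨_, rfl⟩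
  obtain ⟨n, hn⟩ : ∃ n, n = ∑ j, (t j)⁻ • simpleCoroot P b j := ⟨_, rfl⟩
  obtain ⟨p, hp⟩ : ∃ p, p = ∑ j, (t j)⁺ • simpleCoroot P b j := ⟨_, rfl⟩
  rw [← hx] at h
  have hxpn : x = p - n := by
    rw [hx, hp, hn, ← Finset.sum_sub_distrib]
    exact Finset.sum_congr rfl fun j _ => by rw [← sub_smul, posPart_sub_negPart]
  -- With `x = p - n` split by the signs of the coefficients, the hypothesis gives `B n x ≥ 0`,
  -- while obtuseness of the coroots gives `B n p ≤ 0`. Hence `B n n ≤ 0` and `n = 0`.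
  have h1 : 0 ≤ B n x := by
    rw [hn, map_sum, LinearMap.sum_apply]
    refine Finset.sum_nonneg fun j _ => ?_
    rw [map_smul, LinearMap.smul_apply, smul_eq_mul]
    by_cases hj : t j < 0
    · refine mul_nonneg (negPart_nonneg _) ?_
      have h2 := hB.two_mul_apply_coroot (j : ι) x
      have h3 := mul_nonneg (hB.self_nonneg (toCochar P (P.coroot j))) (h j hj)
      change 0 ≤ B (toCochar P (P.coroot j)) x
      linarith
    · rw [negPart_eq_zero.2 (not_lt.1 hj), zero_mul]
  have h2 : B n p ≤ 0 := by
    rw [hn, hp]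
    simp only [map_sum, LinearMap.sum_apply, map_smul, LinearMap.smul_apply, smul_eq_mul,
      Finset.mul_sum]
    refine Finset.sum_nonpos fun j _ => Finset.sum_nonpos fun k _ => ?_
    by_cases hjk : k = j
    · subst hjk
      rcases le_total 0 (t k) with hk | hk
      · simp [negPart_eq_zero.2 hk]
      · simp [posPart_eq_zero.2 hk]
    · exact mul_nonpos_of_nonneg_of_nonpos (posPart_nonneg _)
        (mul_nonpos_of_nonneg_of_nonpos (negPart_nonneg _) (hB.apply_simpleCoroot_nonpos hjk))
  have hn0 : n = 0 := by
    by_contra hne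
    have := hB.pos n hne
    rw [hxpn, map_sub] at h1
    linarith
  have h3 := hw.sum_smul_simpleCoroot_inl (fun j => (t j)⁻) i
  rw [← hn, hn0, LinearMap.zero_apply] at h3
  exact negPart_eq_zero.1 h3.symm

/-- Off the walls of `ν` the bound on `d` is already a bound on `ν`. On a wall `⟨α_i, μ - ν⟩ = ⟨α_i,
μ⟩ ≥ 0`, so `coeff_nonneg` excludes negative coefficients there too. -/
theorem Fits.domLE_iff (hw : IsWeightBasis b w) (hB : IsInvariantInner P B)
    {d : b.support ⊕ κ → EReal} {ν μ : Cochar X} (h : Fits w d ν) (hμ : IsDominant P b μ) :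
    DomLE P b ν μ ↔ (∀ j, d (.inl j) ≤ (μ (w (.inl j)) : ℝ)) ∧
      ∀ k, d (.inr k) = (μ (w (.inr k)) : ℝ) := by
  rw [hw.domLE_iff]
  constructor
  · rintro ⟨h1, h2⟩
    exact ⟨fun j => (h.le j).trans (EReal.coe_le_coe_iff.2 (h1 j)), fun k => by rw [h.inr, h2]⟩
  · rintro ⟨h1, h2⟩
    have h2' (k : κ) : ν (w (.inr k)) = μ (w (.inr k)) :=
      EReal.coe_eq_coe_iff.1 ((h.inr k).symm.trans (h2 k))
    refine ⟨fun j => ?_, h2'⟩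
    have hs := hw.eq_sum_smul_simpleCoroot (x := μ - ν) fun k => by simp [h2']
    refine sub_nonneg.1 (hB.coeff_nonneg hw (t := fun j => (μ - ν) (w (.inl j)))
      (fun i hi => ?_) j)
    rw [← hs]
    by_cases h0 : ν (P.root i) = 0
    · rw [LinearMap.sub_apply, h0, sub_zero]
      exact hμ i
    · have := h1 i
      rw [h.eq i h0, EReal.coe_le_coe_iff] at this
      rw [LinearMap.sub_apply] at hi
      linarith

end DominanceOrder

/-! ### The Newton set in coordinates: dominance plus integrality off the walls. -/

section NewtonSet

variable {ι X Y : Type*} [AddCommGroup X] [AddCommGroup Y] {P : RootPairing ι ℤ X Y}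
variable {b : P.Base} {κ : Type*} {w : Module.Basis (b.support ⊕ κ) ℤ X}

theorem isDominant_of_mem_newtonSet {μ : Cochar X} (hμ : μ ∈ newtonSet P b) :
    IsDominant P b μ := by
  obtain ⟨S, -, h1, h2⟩ := Set.mem_iUnion.1 hμ
  intro i
  by_cases hi : i ∈ S
  · exact (h1 i hi).ge
  · exact (h2 i hi).le

/-- Projecting along the coroots in `S` changes only the coordinates indexed by `S`; the others stay
those of a cocharacter. -/
theorem IsWeightBasis.exists_int_of_mem_newtonSet (hw : IsWeightBasis b w) {μ : Cochar X}
    (hμ : μ ∈ newtonSet P b) : ∃ m : b.support ⊕ κ → ℤ,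
      (∀ j : b.support, μ (P.root j) ≠ 0 → μ (w (.inl j)) = m (.inl j)) ∧
        ∀ k, μ (w (.inr k)) = m (.inr k) := by
  obtain ⟨S, ⟨y, h0, hy⟩, h1, h2⟩ := Set.mem_iUnion.1 hμ
  have key (i : b.support ⊕ κ) (hi : ∀ j ∈ S, i ≠ .inl j) :
      μ (w i) = (P.toLinearMap (w i) y : ℤ) := by
    have : toCochar P y - μ ∈ LinearMap.ker (evalLinear (w i)) := by
      refine Submodule.span_le.2 ?_ hy
      rintro _ ⟨j, hj, rfl⟩
      have := hi j hj
      rcases i with i | k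
      · change simpleCoroot P b j (w (.inl i)) = 0
        rw [hw.simpleCoroot_inl, Finsupp.single_eq_of_ne]
        exact fun h => this (by rw [h])
      · exact hw.simpleCoroot_inr j k
    rw [LinearMap.mem_ker, evalLinear_apply, LinearMap.sub_apply, sub_eq_zero] at this
    exact this.symm
  refine ⟨fun i => P.toLinearMap (w i) y, fun j hj => key _ ?_, fun k => key _ (by simp)⟩
  rintro j' hj' h
  obtain rfl : j = j' := Sum.inl_injective h
  exact hj (h1 j hj')

/-- Take `S` to be the set of walls through `μ`. The perfect pairing realizes `m` by a cocharacter,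
differing from `μ` only along coroots in `S`; the entries of `m` on the walls are arbitrary. -/
theorem IsWeightBasis.mem_newtonSet (hw : IsWeightBasis b w) {μ : Cochar X}
    (hμ : IsDominant P b μ) {m : b.support ⊕ κ → ℤ}
    (h1 : ∀ j : b.support, μ (P.root j) ≠ 0 → μ (w (.inl j)) = m (.inl j))
    (h2 : ∀ k, μ (w (.inr k)) = m (.inr k)) : μ ∈ newtonSet P b := by
  refine Set.mem_iUnion.2 ⟨{j | μ (P.root j) = 0}, ?_, fun j hj => hj,
    fun j hj => lt_of_le_of_ne (hμ j) (Ne.symm hj)⟩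
  refine ⟨P.toLinearMap.flip.toPerfPair.symm (w.constr ℤ m), fun j hj => hj, ?_⟩
  set y := P.toLinearMap.flip.toPerfPair.symm (w.constr ℤ m) with hy
  have hyw (i : b.support ⊕ κ) : toCochar P y (w i) = m i := by
    rw [toCochar_apply, hy, LinearMap.apply_toPerfPair_flip, Module.Basis.constr_basis]
  rw [hw.eq_sum_smul_simpleCoroot (x := toCochar P y - μ) fun k => by
    rw [LinearMap.sub_apply, hyw, h2, sub_self]]
  refine Submodule.sum_mem _ fun j _ => ?_
  by_cases hj : μ (P.root j) = 0
  · exact Submodule.smul_mem _ _ (Submodule.subset_span ⟨j, hj, rfl⟩)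
  · rw [LinearMap.sub_apply, hyw, h1 j hj, sub_self, zero_smul]
    exact zero_mem _

end NewtonSet

/-! ### The valuation and its extension. -/

section Val

variable {O F K : Type*} [CommRing O] [IsDomain O] [IsDiscreteValuationRing O] [Field F]
  [Algebra O F] [IsFractionRing O F] [Field K] [Algebra F K] {v : Valuation K ℚᵐ⁰}

theorem val_zero : val O (0 : F) = ⊥ := if_pos rfl

theorem exists_val_eq_int (O : Type*) [CommRing O] [IsDomain O] [IsDiscreteValuationRing O]
    [Algebra O F] [IsFractionRing O F] {x : F} (hx : x ≠ 0) :
    ∃ m : ℤ, val O x = ((m : ℝ) : EReal) :=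
  ⟨_, if_neg hx⟩

theorem exists_val_eq (O F : Type*) [CommRing O] [IsDomain O] [IsDiscreteValuationRing O]
    [Field F] [Algebra O F] [IsFractionRing O F] (m : ℤ) :
    ∃ x : F, x ≠ 0 ∧ val O x = ((m : ℝ) : EReal) := by
  obtain ⟨p, hp⟩ := (IsDiscreteValuationRing.maximalIdeal O).valuation_exists_uniformizer F
  have hp0 : p ≠ 0 := by
    rintro rfl
    rw [map_zero] at hp
    exact exp_ne_zero hp.symm
  -- The exponent is `-m` because a uniformizer has valuation `-1`.
  refine ⟨p ^ (-m), zpow_ne_zero _ hp0, ?_⟩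
  rw [val, if_neg (zpow_ne_zero _ hp0), map_zpow₀, log_zpow, hp]
  simp

theorem ExtendsVal.val_eq (hv : ExtendsVal O F v) {x : F} (hx : x ≠ 0) :
    val O x = (((log (v (algebraMap F K x)) : ℚ) : ℝ) : EReal) := by
  rw [val, if_neg hx, hv x hx]
  simp

theorem ExtendsVal.val_le (hv : ExtendsVal O F v) {x : F} {γ : ℚᵐ⁰} (hγ : γ ≠ 0)
    (h : v (algebraMap F K x) ≤ γ) : val O x ≤ (((log γ : ℚ) : ℝ) : EReal) := by
  by_cases hx : x = 0
  · rw [hx, val_zero]; exact bot_le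
  · rw [hv.val_eq hx]
    have hx' : v (algebraMap F K x) ≠ 0 := by simpa using hx
    exact_mod_cast (log_le_log hx' hγ).2 h

theorem ExtendsVal.val_eq_of_eq (hv : ExtendsVal O F v) {x : F} {γ : ℚᵐ⁰} (hγ : γ ≠ 0)
    (h : v (algebraMap F K x) = γ) : val O x = (((log γ : ℚ) : ℝ) : EReal) := by
  have hx : x ≠ 0 := by
    rintro rfl
    exact hγ (by simpa using h.symm)
  rw [hv.val_eq hx, h]

end Val

/-! ### Newton points of elements of the adjoint quotient. -/

section Points

variable {O F K : Type*} [CommRing O] [IsDomain O] [IsDiscreteValuationRing O] [Field F]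
  [Algebra O F] [IsFractionRing O F] [Field K] [Algebra F K] {v : Valuation K ℚᵐ⁰}
variable {ι X Y : Type*} [AddCommGroup X] [AddCommGroup Y] {P : RootPairing ι ℤ X Y}

theorem nu_apply (a : AddMonoidAlgebra F X →ₐ[F] K) (l : X) :
    nu v a l = ((log (v (a (AddMonoidAlgebra.single l 1))) : ℚ) : ℝ) := rfl

theorem valuation_apply_single_ne_zero (v : Valuation K ℚᵐ⁰) (a : AddMonoidAlgebra F X →ₐ[F] K)
    (l : X) : v (a (AddMonoidAlgebra.single l 1)) ≠ 0 := by
  have h : IsUnit (AddMonoidAlgebra.single l (1 : F)) :=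
    IsUnit.of_mul_eq_one (AddMonoidAlgebra.single (-l) 1)
      (by simp [AddMonoidAlgebra.single_mul_single, AddMonoidAlgebra.one_def])
  exact (Valuation.ne_zero_iff v).2 (h.map a).ne_zero

theorem nu_comp_weylAct (v : Valuation K ℚᵐ⁰) (a : AddMonoidAlgebra F X →ₐ[F] K)
    (g : P.weylGroup) :
    nu v (a.comp (weylAct P F g⁻¹ : AddMonoidAlgebra F X →ₐ[F] _)) = weylTranslate g (nu v a) := by
  ext l
  rw [weylTranslate_apply, nu_apply, nu_apply]
  simp [weylAct]

variable [Finite ι] [P.IsReduced] {b : P.Base} {κ : Type*}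
  {w : Module.Basis (b.support ⊕ κ) ℤ X}

/-- Ultrametric estimate of the orbit sum of `ω_j` at `a`: no term exceeds that of `ω_j`, and off
the walls every other term is strictly smaller. A central orbit sum has a single term. -/
theorem fits_nu (hv : ExtendsVal O F v) (hw : IsWeightBasis b w) {c : AdjQuotient P F F}
    {a : AddMonoidAlgebra F X →ₐ[F] K} (ha : quotientMap P F a = extendPoint P F K c)
    (hdom : IsDominant P b (nu v a)) :
    Fits w (fun i => val O (coords P F w c i)) (nu v a) := by
  classical
  have hc (i : b.support ⊕ κ) : algebraMap F K (coords P F w c i) =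
      ∑ l ∈ (finite_orbit (P := P) (w i)).toFinset, a (AddMonoidAlgebra.single l 1) := by
    rw [← map_sum, ← orbitSum_eq_sum]
    exact (DFunLike.congr_fun ha ⟨orbitSum P F (w i), orbitSum_mem P F (w i)⟩).symm
  have hle {l l' : X} (h : nu v a l ≤ nu v a l') :
      v (a (AddMonoidAlgebra.single l 1)) ≤ v (a (AddMonoidAlgebra.single l' 1)) := by
    rw [← log_le_log (valuation_apply_single_ne_zero v a l) (valuation_apply_single_ne_zero v a l')]
    rw [nu_apply, nu_apply] at h
    exact_mod_cast h
  refine ⟨hdom, fun j => ?_, fun j hj => ?_, fun k => ?_⟩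
  · refine hv.val_le (valuation_apply_single_ne_zero v a _) ?_
    rw [hc]
    refine v.map_sum_le fun l hl => hle ?_
    obtain ⟨g, rfl⟩ := (Set.Finite.mem_toFinset _).1 hl
    exact (hw.isDominantChar_inl j).apply_smul_le g hdom
  · refine hv.val_eq_of_eq (valuation_apply_single_ne_zero v a _) ?_
    rw [hc]
    refine v.map_sum_eq_of_lt (by simp) fun l hl => ?_
    obtain ⟨hl, hne⟩ := Finset.mem_sdiff.1 hl
    obtain ⟨g, rfl⟩ := (Set.Finite.mem_toFinset _).1 hl
    rw [← log_lt_log (valuation_apply_single_ne_zero v a _) (valuation_apply_single_ne_zero v a _)]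
    have h := hw.apply_smul_lt hdom hj (g := g) (by simpa using hne)
    rw [nu_apply, nu_apply] at h
    exact_mod_cast h
  · refine hv.val_eq_of_eq (valuation_apply_single_ne_zero v a _) ?_
    have := DFunLike.congr_fun ha ⟨orbitSum P F (w (.inr k)), orbitSum_mem P F _⟩
    have h2 : algebraMap F K (coords P F w c (.inr k)) = a (orbitSum P F (w (.inr k))) := this.symm
    rw [h2, orbitSum_of_forall_smul_eq (hw.smul_inr k)]

theorem exists_weylTranslate_fits (hv : ExtendsVal O F v) (hw : IsWeightBasis b w)
    {c : AdjQuotient P F F} {a : AddMonoidAlgebra F X →ₐ[F] K}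
    (ha : quotientMap P F a = extendPoint P F K c) : ∃ g : P.weylGroup,
      Fits w (fun i => val O (coords P F w c i)) (weylTranslate g (nu v a)) := by
  obtain ⟨g, hg⟩ := exists_weylTranslate_isDominant hw (nu v a)
  refine ⟨g, ?_⟩
  rw [← nu_comp_weylAct] at hg ⊢
  exact fits_nu hv hw ((quotientMap_comp_weylAct a g⁻¹).trans ha) hg

theorem setOf_mem_weylOrbit_isDominant_eq (hw : IsWeightBasis b w) {x : Cochar X}
    {g : P.weylGroup} (hg : IsDominant P b (weylTranslate g x)) :
    {y | y ∈ weylOrbit P x ∧ IsDominant P b y} = {weylTranslate g x} := by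
  refine Set.eq_singleton_iff_unique_mem.2 ⟨⟨mem_weylOrbit_iff.2 ⟨g, rfl⟩, hg⟩, ?_⟩
  rintro y ⟨hy, hyd⟩
  obtain ⟨h, rfl⟩ := mem_weylOrbit_iff.1 hy
  have : weylTranslate h x = weylTranslate (h * g⁻¹) (weylTranslate g x) := by
    ext l
    simp only [weylTranslate_apply, mul_inv_rev, inv_inv, mul_smul, inv_smul_smul]
  rw [this] at hyd ⊢
  exact hw.weylTranslate_eq_self hg hyd

theorem Fits.mem_newtonSet [Fintype κ] (hw : IsWeightBasis b w) {c : AdjQuotient P F F}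
    {μ : Cochar X} (h : Fits w (fun i => val O (coords P F w c i)) μ) : μ ∈ newtonSet P b := by
  have hint {x : F} {r : ℝ} (hx : val O x = (r : EReal)) : r = (⌊r⌋ : ℤ) := by
    have hx0 : x ≠ 0 := by
      rintro rfl
      rw [val_zero] at hx
      exact EReal.bot_ne_coe _ hx
    obtain ⟨m, hm⟩ := exists_val_eq_int O hx0
    rw [hx, EReal.coe_eq_coe_iff] at hm
    rw [hm, Int.floor_intCast]
  -- The floor is exact wherever a coordinate of `μ` equals a valuation; on the walls its value is
  -- irrelevant.
  exact hw.mem_newtonSet (m := fun i => ⌊μ (w i)⌋) h.isDominant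
    (fun j hj => hint (h.eq j hj)) fun k => hint (h.inr k)

theorem exists_fits_of_mem_newtonSet [Fintype κ] (hw : IsWeightBasis b w) {μ : Cochar X}
    (hμ : μ ∈ newtonSet P b) :
    ∃ c : AdjQuotient P F F, Fits w (fun i => val O (coords P F w c i)) μ := by
  classical
  obtain ⟨m, h1, h2⟩ := hw.exists_int_of_mem_newtonSet hμ
  choose f hf0 hf using exists_val_eq O F
  -- On the walls only an upper bound is needed, so the coordinate `0`, of valuation `-∞`, will do.
  obtain ⟨c, -, hc⟩ := (bijOn_coords (F := F) hw).surjOn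
    (show Sum.elim (fun j : b.support => if μ (P.root j) = 0 then 0 else f (m (.inl j)))
      (fun k => f (m (.inr k))) ∈ _ from fun k => hf0 _)
  refine ⟨c, ?_⟩
  rw [hc]
  refine ⟨isDominant_of_mem_newtonSet hμ, fun j => ?_, fun j hj => ?_, fun k => ?_⟩
  · by_cases hj : μ (P.root j) = 0
    · simp [hj, val_zero]
    · simp [hj, hf, h1 j hj]
  · simp [hj, hf, h1 j hj]
  · simp [hf, h2]

/-- A lift of `c` to `A(K)` provides a point that fits, and any point that fits equals the limit
defining `newtonPoint`. -/
theorem newtonPoint_eq_iff [Fintype κ] [IsAlgClosed K] (hv : ExtendsVal O F v)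
    (hw : IsWeightBasis b w) {B : LinearMap.BilinForm ℝ (Cochar X)} (hB : IsInvariantInner P B)
    {c : AdjQuotient P F F} {μ : Cochar X} : newtonPoint P b B O F w c = μ ↔
      Fits w (fun i => val O (coords P F w c i)) μ := by
  refine ⟨?_, fun h => h.closestExt_eq hw hB⟩
  rintro rfl
  obtain ⟨a, ha⟩ := exists_quotientMap_eq (extendPoint P F K c)
  obtain ⟨g, hg⟩ := exists_weylTranslate_fits hv hw ha
  rwa [newtonPoint, hg.closestExt_eq hw hB]

end Points

end NewtonStrata

end

theorem mainTheorem4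
    -- the complete discrete valuation ring `O` with algebraically closed residue field,
    -- its fraction field `F`, and an algebraic closure `K` of `F` with the extended valuation `v`
    {O F K : Type*} [CommRing O] [IsDomain O] [IsDiscreteValuationRing O]
    [IsAdicComplete (IsLocalRing.maximalIdeal O) O] [IsAlgClosed (IsLocalRing.ResidueField O)]
    [Field F] [Algebra O F] [IsFractionRing O F]
    [Field K] [Algebra F K] [IsAlgClosure F K]
    (v : Valuation K ℚᵐ⁰) (hv : NewtonStrata.ExtendsVal O F v)
    -- the root datum of a split connected reductive group, with a base of simple roots
    {ι X Y : Type*} [Finite ι] [DecidableEq ι] [AddCommGroup X] [AddCommGroup Y]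
    [Module.Finite ℤ X] [Module.Free ℤ X] [Module.Finite ℤ Y] [Module.Free ℤ Y]
    (P : RootPairing ι ℤ X Y) [P.IsReduced] (b : P.Base)
    -- the derived group is simply connected
    (hsc : ∀ (m : ℤ) (y : Y), m ≠ 0 →
      m • y ∈ Submodule.span ℤ (Set.range P.coroot) → y ∈ Submodule.span ℤ (Set.range P.coroot))
    -- a Weyl group invariant inner product on `𝔞`
    (B : LinearMap.BilinForm ℝ (NewtonStrata.Cochar X)) (hB : NewtonStrata.IsInvariantInner P B)
    -- extensions `ω_1, …, ω_l` of the fundamental weights, and a basis `ω_{l+1}, …, ω_n` of `X^*(D)`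
    (ω₁ : b.support → X)
    (hω₁ : ∀ i j : b.support, P.toLinearMap (ω₁ i) (P.coroot j) = if i = j then 1 else 0)
    {κ : Type*} [Finite κ] (ω₂ : Module.Basis κ ℤ (NewtonStrata.charD P))
    (ω : b.support ⊕ κ → X) (hω : ω = Sum.elim ω₁ (fun k => (ω₂ k : X))) :
    -- `𝔸(F) = F^l × (F^×)^{n-l}` through the coordinates `c_1, …, c_n`
    Set.BijOn (NewtonStrata.coords P F ω) Set.univ {t | ∀ k : κ, t (Sum.inr k) ≠ 0} ∧
    -- the strata are non-empty and partition `𝔸(F)`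
    ((∀ μ ∈ NewtonStrata.newtonSet P b, (NewtonStrata.stratum P b B O F ω μ).Nonempty) ∧
      (NewtonStrata.newtonSet P b).PairwiseDisjoint (NewtonStrata.stratum P b B O F ω) ∧
      (⋃ μ ∈ NewtonStrata.newtonSet P b, NewtonStrata.stratum P b B O F ω μ) = Set.univ) ∧
    -- a closed stratum is the (disjoint) union of the strata below it
    (∀ μ ∈ NewtonStrata.newtonSet P b,
      NewtonStrata.closedStratum P b B O F ω μ =
        ⋃ ν ∈ {ν | ν ∈ NewtonStrata.newtonSet P b ∧ NewtonStrata.DomLE P b ν μ},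
          NewtonStrata.stratum P b B O F ω ν) ∧
    -- explicit description of the closed strata
    (∀ μ ∈ NewtonStrata.newtonSet P b, ∀ c : NewtonStrata.AdjQuotient P F F,
      c ∈ NewtonStrata.closedStratum P b B O F ω μ ↔
        (∀ i : b.support, NewtonStrata.val O (NewtonStrata.coords P F ω c (Sum.inl i)) ≤
          ((μ (ω (Sum.inl i)) : ℝ) : EReal)) ∧
        (∀ k : κ, NewtonStrata.val O (NewtonStrata.coords P F ω c (Sum.inr k)) =
          ((μ (ω (Sum.inr k)) : ℝ) : EReal))) ∧
    -- explicit description of the strata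
    (∀ μ ∈ NewtonStrata.newtonSet P b, ∀ c : NewtonStrata.AdjQuotient P F F,
      c ∈ NewtonStrata.stratum P b B O F ω μ ↔
        (∀ i ∈ NewtonStrata.wallSet P b κ μ,
          NewtonStrata.val O (NewtonStrata.coords P F ω c i) ≤ ((μ (ω i) : ℝ) : EReal)) ∧
        (∀ i ∉ NewtonStrata.wallSet P b κ μ,
          NewtonStrata.val O (NewtonStrata.coords P F ω c i) = ((μ (ω i) : ℝ) : EReal))) ∧
    -- every `c ∈ 𝔸(F)` is `c(a)` for some `a ∈ A(K)`, and for every such `a`, the stratum of `c`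
    -- is the one indexed by the unique dominant element of the Weyl group orbit of `ν_a`
    (∀ c : NewtonStrata.AdjQuotient P F F,
      (∃ a : AddMonoidAlgebra F X →ₐ[F] K,
        NewtonStrata.quotientMap P F a = NewtonStrata.extendPoint P F K c) ∧
      ∀ a : AddMonoidAlgebra F X →ₐ[F] K,
        NewtonStrata.quotientMap P F a = NewtonStrata.extendPoint P F K c →
        ∀ μ ∈ NewtonStrata.newtonSet P b,
          (c ∈ NewtonStrata.stratum P b B O F ω μ ↔
            {x | x ∈ NewtonStrata.weylOrbit P (NewtonStrata.nu v a) ∧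
              NewtonStrata.IsDominant P b x} = {μ})) := by
  classical
  have := Fintype.ofFinite κ
  have : IsAlgClosed K := IsAlgClosure.isAlgClosed F
  obtain ⟨w, hw, hwω⟩ := NewtonStrata.exists_isWeightBasis ω₁ hω₁ ω₂
  rw [← hwω] at hω
  subst hω
  have hfits (c : NewtonStrata.AdjQuotient P F F) :=
    (NewtonStrata.newtonPoint_eq_iff (c := c) hv hw hB).1 rfl
  have hmem (c : NewtonStrata.AdjQuotient P F F) :
      NewtonStrata.newtonPoint P b B O F w c ∈ NewtonStrata.newtonSet P b :=
    (hfits c).mem_newtonSet hw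
  refine ⟨NewtonStrata.bijOn_coords hw, ⟨fun μ hμ => ?_, ?_, ?_⟩, fun μ _ => ?_,
    fun μ hμ c => ?_, fun μ hμ c => ?_, fun c => ⟨NewtonStrata.exists_quotientMap_eq _, ?_⟩⟩
  · obtain ⟨c, hc⟩ := NewtonStrata.exists_fits_of_mem_newtonSet (O := O) (F := F) hw hμ
    exact ⟨c, (NewtonStrata.newtonPoint_eq_iff hv hw hB).2 hc⟩
  · intro μ _ ν _ hne
    exact Set.disjoint_left.2 fun c hμ hν => hne (Eq.trans (Eq.symm hμ) hν)
  · exact Set.eq_univ_of_forall fun c => Set.mem_biUnion (hmem c) rfl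
  · ext c
    simp only [Set.mem_iUnion, exists_prop]
    constructor
    · exact fun h => ⟨_, ⟨hmem c, h⟩, rfl⟩
    · rintro ⟨ν, ⟨-, hνμ⟩, rfl⟩
      exact hνμ
  · exact (hfits c).domLE_iff hw hB (NewtonStrata.isDominant_of_mem_newtonSet hμ)
  · refine (NewtonStrata.newtonPoint_eq_iff hv hw hB).trans ⟨fun h => ⟨?_, ?_⟩, fun h => ?_⟩
    · rintro _ ⟨j, -, rfl⟩
      exact h.le j
    · rintro (j | k) hi
      · exact h.eq j fun h0 => hi ⟨j, h0, rfl⟩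
      · exact h.inr k
    · have hout (j : b.support) (hj : μ (P.root j) ≠ 0) := h.2 (.inl j) (by
        rintro ⟨i, hi, hij⟩
        exact hj (Sum.inl_injective hij ▸ hi))
      refine ⟨NewtonStrata.isDominant_of_mem_newtonSet hμ, fun j => ?_, hout, fun k => ?_⟩
      · by_cases hj : μ (P.root j) = 0
        · exact h.1 _ ⟨j, hj, rfl⟩
        · exact (hout j hj).le
      · exact h.2 _ (by rintro ⟨i, -, hi⟩; cases hi)
  · intro a ha μ _
    obtain ⟨g, hg⟩ := NewtonStrata.exists_weylTranslate_fits hv hw ha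
    rw [NewtonStrata.setOf_mem_weylOrbit_isDominant_eq hw hg.isDominant,
      Set.singleton_eq_singleton_iff, ← (NewtonStrata.newtonPoint_eq_iff hv hw hB).2 hg]
    rfl
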